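/- Let $M$ be a compact connected smooth Riemannian manifold without boundary, of dimension $p$ (oriented or not), with metric tensor $G=(g_{ij})$ in local coordinates and uniform (Riemannian) measure $\mu(dx)=\{\det G(x)\}^{1/2}dx$. For functions $u,v$ on $M$ write, in local coordinates, $$\langle u,v\rangle=(\nabla u)^TG^{-1}\nabla v,\qquad \Delta_M u=\sum_{i,j=1}^p\{\det G\}^{-1/2}\frac{\partial}{\partial x_i}\Big[\{\det G\}^{1/2}g^{ij}\frac{\partial u}{\partial x_j}\Big].$$ Let $t_1,\dots,t_m$ be twice continuously differentiable real functions on $M$ such that $1,t_1,\dots,t_m$ are linearly independent, and for $\pi\in\mathbb{R}^m$ let $$f(x;\pi)=\frac{\exp\{\pi^Tt(x)\}}{\int_M\exp\{\pi^Tt(y)\}\,\mu(dy)}$$ be the density with respect to $\mu$ of the canonical exponential family with sufficient statistic $t=(t_1,\dots,t_m)^T$. Let $x_1,x_2,\dots$ be independent random points of $M$ with the common density $f(\cdot\,;\pi_0)$, where $\pi_0\in\mathbb{R}^m$, and define the $m\times m$ matrix $W_n$, the $m$-vector $d_n$ and the score matching estimator $\hat\pi_{\mathrm{SME}}$ by $$(W_n)_{ab}=\frac1n\sum_{h=1}^n\langle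 t_a,t_b\rangle(x_h),\qquad (d_n)_a=-\frac1n\sum_{h=1}^n\Delta_M t_a(x_h),\qquad \hat\pi_{\mathrm{SME}}=W_n^{-1}d_n$$ (with an arbitrary convention for $W_n^{-1}$, say the zero matrix, where $W_n$ is singular). Then: 1. almost surely, $W_n$ is positive definite for all sufficiently large $n$; 2. $\hat\pi_{\mathrm{SME}}\to\pi_0$ almost surely as $n\to\infty$; 3. there is a positive semidefinite $m\times m$ matrix $\Omega$, depending only on $M$, its metric, $t$ and $\pi_0$, such that $\sqrt n\,(\hat\pi_{\mathrm{SME}}-\pi_0)$ converges in distribution to $N_m(0,\Omega)$ as $n\to\infty$; 4. the Fisher information matrix $\mathcal I=\big(E_{\pi_0}[\partial_{\pi_a}\log f(x;\pi_0)\,\partial_{\pi_b}\log f(x;\pi_0)]\big)_{a,b}$ of one observation is positive definite, and $\Omega-\mathcal I^{-1}$ is positive semidefinite. -/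

import Mathlib

open MeasureTheory ProbabilityTheory Filter Topology
open scoped Manifold ContDiff Matrix

universe u v

noncomputable section

namespace ScoreMatching

/-- The model space `ℝ^p` of the local coordinates. -/
abbrev Coord (p : ℕ) : Type := EuclideanSpace ℝ (Fin p)

/-- The partial derivative `∂f/∂x_i` of a function of the local coordinates `x`. -/
def partialDeriv {p : ℕ} (i : Fin p) (f : Coord p → ℝ) (x : Coord p) : ℝ :=
  fderiv ℝ f x (EuclideanSpace.single i 1)

section Geometry

variable {p : ℕ} {M : Type u} [TopologicalSpace M] [ChartedSpace (Coord p) M]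
  [IsManifold (𝓡 p) ∞ M]

/-- A smooth Riemannian metric on the `p`-dimensional smooth manifold `M`. -/
abbrev RiemannianMetric (p : ℕ) (M : Type u) [TopologicalSpace M] [ChartedSpace (Coord p) M]
    [IsManifold (𝓡 p) ∞ M] : Type u :=
  Bundle.ContMDiffRiemannianMetric (𝓡 p) ∞ (Coord p) (fun y : M => TangentSpace (𝓡 p) y)

/-- The coordinate vector field `∂/∂x_i` of the chart around `c`, at the point of `M` that has
coordinates `x` in that chart. -/
def coordVec (c : M) (x : Coord p) (i : Fin p) :
    TangentSpace (𝓡 p) ((extChartAt (𝓡 p) c).symm x) :=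
  mfderiv 𝓘(ℝ, Coord p) (𝓡 p) (extChartAt (𝓡 p) c).symm x
    (EuclideanSpace.single i (1 : ℝ) : Coord p)

/-- The metric tensor `G(x) = (g_ij(x))` in the local coordinates of the chart around `c`. -/
def metricTensor (g : RiemannianMetric p M) (c : M) (x : Coord p) : Matrix (Fin p) (Fin p) ℝ :=
  Matrix.of fun i j =>
    g.inner ((extChartAt (𝓡 p) c).symm x) (coordVec c x i) (coordVec c x j)

/-- The function `w` on `M` written in the local coordinates of the chart around `c`. -/
def inCoord (c : M) (w : M → ℝ) (x : Coord p) : ℝ :=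
  w ((extChartAt (𝓡 p) c).symm x)

/-- The gradient inner product `⟨u, w⟩ = (∇u)ᵀ G⁻¹ (∇w)` at the point `y`, computed in the chart
around `y`. -/
def gradInner (g : RiemannianMetric p M) (u w : M → ℝ) (y : M) : ℝ :=
  ∑ i, ∑ j,
    partialDeriv i (inCoord y u) (extChartAt (𝓡 p) y y) *
      (metricTensor g y (extChartAt (𝓡 p) y y))⁻¹ i j *
      partialDeriv j (inCoord y w) (extChartAt (𝓡 p) y y)

/-- The Laplace-Beltrami operator
`Δu = ∑ i j, (det G)^(-1/2) ∂/∂x_i [(det G)^(1/2) g^{ij} ∂u/∂x_j]` at the point `y`, computed in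
the chart around `y`. -/
def laplaceBeltrami (g : RiemannianMetric p M) (u : M → ℝ) (y : M) : ℝ :=
  ∑ i, ∑ j,
    (√(metricTensor g y (extChartAt (𝓡 p) y y)).det)⁻¹ *
      partialDeriv i
        (fun x => √(metricTensor g y x).det * (metricTensor g y x)⁻¹ i j *
          partialDeriv j (inCoord y u) x)
        (extChartAt (𝓡 p) y y)

variable [MeasurableSpace M]

/-- The part of the uniform measure that lies in the domain of the chart around `c`: the image in
`M` of the measure `(det G(x))^(1/2) dx` on the range of the chart. -/
def chartVolume (g : RiemannianMetric p M) (c : M) : Measure M :=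
  (((volume : Measure (Coord p)).restrict (extChartAt (𝓡 p) c).target).withDensity
    fun x => ENNReal.ofReal √(metricTensor g c x).det).map (extChartAt (𝓡 p) c).symm

/-- The uniform (Riemannian) measure `μ(dx) = (det G(x))^(1/2) dx` on `M`. The measures
`chartVolume g c` agree on the overlaps of the charts, so that the smallest measure above all of
them is the measure that has this expression in every chart. -/
def uniformMeasure (g : RiemannianMetric p M) : Measure M :=
  ⨆ c : M, chartVolume g c

end Geometry

section ExponentialFamily

variable {M : Type u} [MeasurableSpace M] {m : ℕ}

/-- The density `f(x; π) = exp(πᵀ t(x)) / ∫ exp(πᵀ t) dμ` of the canonical exponential family. -/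
def density (μ : Measure M) (t : Fin m → M → ℝ) (π : EuclideanSpace ℝ (Fin m)) (x : M) : ℝ :=
  Real.exp (∑ l, π l * t l x) / ∫ y, Real.exp (∑ l, π l * t l y) ∂μ

/-- The distribution with density `f(x; π)` with respect to `μ`. -/
def expFamily (μ : Measure M) (t : Fin m → M → ℝ) (π : EuclideanSpace ℝ (Fin m)) : Measure M :=
  μ.withDensity fun x => ENNReal.ofReal (density μ t π x)

/-- The Fisher information matrix `E_π[(∂ log f/∂π_a) (∂ log f/∂π_b)]` of one observation. -/
def fisherInformation (μ : Measure M) (t : Fin m → M → ℝ) (π : EuclideanSpace ℝ (Fin m)) :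
    Matrix (Fin m) (Fin m) ℝ :=
  Matrix.of fun a b =>
    ∫ x, partialDeriv a (fun θ => Real.log (density μ t θ x)) π *
      partialDeriv b (fun θ => Real.log (density μ t θ x)) π ∂(expFamily μ t π)

end ExponentialFamily

section Estimator

variable {p : ℕ} {M : Type u} [TopologicalSpace M] [ChartedSpace (Coord p) M]
  [IsManifold (𝓡 p) ∞ M] {m : ℕ}

/-- The matrix `W_n`, with entries the averages of `⟨t_a, t_b⟩` over the data
`x 0, …, x (n - 1)`. -/
def sampleW (g : RiemannianMetric p M) (t : Fin m → M → ℝ) (n : ℕ) (x : ℕ → M) :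
    Matrix (Fin m) (Fin m) ℝ :=
  Matrix.of fun a b => (n : ℝ)⁻¹ * ∑ h ∈ Finset.range n, gradInner g (t a) (t b) (x h)

/-- The vector `d_n`, with entries minus the averages of `Δ t_a` over the data
`x 0, …, x (n - 1)`. -/
def sampleD (g : RiemannianMetric p M) (t : Fin m → M → ℝ) (n : ℕ) (x : ℕ → M) : Fin m → ℝ :=
  fun a => -((n : ℝ)⁻¹ * ∑ h ∈ Finset.range n, laplaceBeltrami g (t a) (x h))

/-- The score matching estimator `W_n⁻¹ d_n` computed from the data `x 0, …, x (n - 1)`. -/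
def sme (g : RiemannianMetric p M) (t : Fin m → M → ℝ) (n : ℕ) (x : ℕ → M) :
    EuclideanSpace ℝ (Fin m) :=
  WithLp.toLp 2 ((sampleW g t n x)⁻¹ *ᵥ sampleD g t n x)

end Estimator

end ScoreMatching

end

/-!
The proof rests on Green's formula `∫ v Δu dμ = -∫ ⟨v, u⟩ dμ` on the closed manifold `M`
(`integral_mul_laplaceBeltrami`). Applied with `v` replaced by `v` times the density `f`, whose
gradient is `f ∇(πᵀt)`, it gives for the estimating function `Y_a = -Δ t_a - ∑ b, ⟨t_a, t_b⟩ π_b`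
the identity `E[v Y_a] = E⟨v, t_a⟩` (`integral_mul_scoreResidual`). With `v = 1` it says that `Y`
has mean zero, so that `π₀` solves `W π = d` for the expectations `W` and `d` of `W_n` and `d_n`;
with `v = t_b` it says that the covariance of `Y` and `t` is `W`.

The matrix `W` is positive definite, because `rᵀ W r = E⟨u, u⟩` with `u = rᵀ t`, and this vanishes
only if `u` has zero gradient, hence is constant on the connected manifold
(`posDef_integral_gradInner`). The strong law of large numbers then gives the first two claims. For
the third, the error is written with the influence function `ψ = W⁻¹ Y` as
`√n (π̂ - π₀) = (W_n⁻¹ W) n^(-1/2) ∑ ψ(x_h) + √n (W_n⁻¹ W_n - 1) π₀`,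
where the last term is eventually zero; the central limit theorem and Slutsky's theorem give the
limit `N(0, Ω)` with `Ω = E[ψ ψᵀ]` (`asymptotics_empSolution`). The Fisher information `I` is the
covariance of `T = t - E t`, and `E[ψ Tᵀ] = 1`, so `Ω - I⁻¹` is the matrix of second moments of
`ψ - I⁻¹ T` (`posSemidef_secondMoment_sub_inv`).

Green's formula is proved in each chart by integration by parts for functions supported there, and
glued with a partition of unity. This needs the gradient inner product, the measure and the
Laplace-Beltrami operator to be independent of the chart. For the first two this is the chain rule
and the change of variables formula. For the operator it follows from Green's formula in the
charts: in two charts it has the same integrals against all test functions supported in the common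
domain (`chartLaplace_eq_chartLaplace`), so that no second derivatives of transition maps occur.
-/

noncomputable section

namespace ScoreMatching

/-! ### The metric tensor and the change of charts -/

section ChartCalculus

variable {p : ℕ} {M : Type u} [TopologicalSpace M] [ChartedSpace (Coord p) M]

/-- The transition map from the chart around `c` to the chart around `c'`. -/
def transition (c c' : M) (x : Coord p) : Coord p :=
  extChartAt (𝓡 p) c' ((extChartAt (𝓡 p) c).symm x)

/-- The Jacobian matrix of the transition map. -/
def jacobian (c c' : M) (x : Coord p) : Matrix (Fin p) (Fin p) ℝ :=
  Matrix.of fun k i => fderiv ℝ (transition c c') x (EuclideanSpace.single i 1) k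

/-- The part of the chart around `c` on which also the chart around `c'` is defined. -/
def overlap (c c' : M) : Set (Coord p) :=
  (extChartAt (𝓡 p) c).target ∩ (extChartAt (𝓡 p) c).symm ⁻¹' (extChartAt (𝓡 p) c').source

theorem isOpen_overlap (c c' : M) : IsOpen (overlap (p := p) c c') :=
  (continuousOn_extChartAt_symm c).isOpen_inter_preimage (isOpen_extChartAt_target c)
    (isOpen_extChartAt_source c')

theorem transition_mem {c c' : M} {x : Coord p} (hx : x ∈ overlap (p := p) c c') :
    transition c c' x ∈ overlap (p := p) c' c := by
  refine ⟨(extChartAt (𝓡 p) c').map_source hx.2, ?_⟩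
  simp only [Set.mem_preimage, transition]
  rw [(extChartAt (𝓡 p) c').left_inv hx.2]
  exact (extChartAt (𝓡 p) c).map_target hx.1

theorem symm_transition {c c' : M} {x : Coord p} (hx : x ∈ overlap (p := p) c c') :
    (extChartAt (𝓡 p) c').symm (transition c c' x) = (extChartAt (𝓡 p) c).symm x :=
  (extChartAt (𝓡 p) c').left_inv hx.2

theorem transition_transition {c c' : M} {x : Coord p} (hx : x ∈ overlap (p := p) c c') :
    transition c' c (transition c c' x) = x := by
  rw [transition, symm_transition hx, (extChartAt (𝓡 p) c).right_inv hx.1]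

theorem transition_injOn (c c' : M) :
    Set.InjOn (transition (p := p) c c') (overlap (p := p) c c') := by
  intro x hx y hy h
  rw [← transition_transition hx, h, transition_transition hy]

theorem fderiv_transition_apply (c c' : M) (x : Coord p) (i : Fin p) :
    fderiv ℝ (transition c c') x (EuclideanSpace.single i 1) =
      ∑ k, jacobian c c' x k i • EuclideanSpace.single k (1 : ℝ) := by
  ext l
  simp [jacobian, Finset.sum_apply, Pi.single_apply]

theorem jacobian_eq_toMatrix (c c' : M) (x : Coord p) :
    jacobian c c' x = LinearMap.toMatrix (EuclideanSpace.basisFun (Fin p) ℝ).toBasis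
      (EuclideanSpace.basisFun (Fin p) ℝ).toBasis (fderiv ℝ (transition c c') x).toLinearMap := by
  ext k i
  simp [jacobian, LinearMap.toMatrix_apply]

/-- Identifies the determinant in the change of variables formula for Lebesgue measure with the
one in the transformation rule of the metric tensor. -/
theorem det_fderiv_transition (c c' : M) (x : Coord p) :
    (fderiv ℝ (transition c c') x).det = (jacobian c c' x).det := by
  rw [jacobian_eq_toMatrix, LinearMap.det_toMatrix, ContinuousLinearMap.det]

theorem image_extChartAt_inter_source (c : M) (A : Set M) :
    (extChartAt (𝓡 p) c).target ∩ (extChartAt (𝓡 p) c).symm ⁻¹' A =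
      extChartAt (𝓡 p) c '' ((extChartAt (𝓡 p) c).source ∩ A) :=
  ((extChartAt (𝓡 p) c).image_source_inter_eq' A).symm

theorem inCoord_self (y : M) (u : M → ℝ) :
    inCoord (p := p) y u (extChartAt (𝓡 p) y y) = u y := by
  rw [inCoord, extChartAt_to_inv]

theorem measurableSet_target (c : M) : MeasurableSet (extChartAt (𝓡 p) c).target :=
  (isOpen_extChartAt_target c).measurableSet

theorem measurableSet_target_inter_preimage [MeasurableSpace M] [BorelSpace M] (c : M) {A : Set M}
    (hA : MeasurableSet A) :
    MeasurableSet ((extChartAt (𝓡 p) c).target ∩ (extChartAt (𝓡 p) c).symm ⁻¹' A) := by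
  have h := (continuousOn_extChartAt_symm (I := 𝓡 p) c).domRestrict.measurable hA
  have h2 := (MeasurableEmbedding.subtype_coe (measurableSet_target (p := p) c)
    ).measurableSet_image.2 h
  convert h2 using 1
  ext x
  simp [and_comm]

theorem aemeasurable_extChartAt_symm [MeasurableSpace M] [BorelSpace M] (c : M) :
    AEMeasurable (extChartAt (𝓡 p) c).symm (volume.restrict (extChartAt (𝓡 p) c).target) :=
  (continuousOn_extChartAt_symm c).aemeasurable (measurableSet_target c)

/-- The cover is finite by compactness; indexing it by `ℕ` lets it be cut into disjoint pieces
with `disjointed`. -/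
theorem exists_seq_chart_cover [CompactSpace M] [Nonempty M] :
    ∃ f : ℕ → M, ⋃ n, (extChartAt (𝓡 p) (f n)).source = Set.univ := by
  obtain ⟨s, hs⟩ := isCompact_univ.elim_finite_subcover
    (fun c : M => (extChartAt (𝓡 p) c).source) (fun c => isOpen_extChartAt_source c)
    (fun y _ => Set.mem_iUnion.2 ⟨y, mem_extChartAt_source y⟩)
  have hne : (s : Set M).Nonempty := by
    obtain ⟨y⟩ := ‹Nonempty M›
    obtain ⟨c, hc⟩ := Set.mem_iUnion.1 (hs (Set.mem_univ y))
    obtain ⟨hcs, -⟩ := Set.mem_iUnion.1 hc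
    exact ⟨c, hcs⟩
  obtain ⟨f, hf⟩ := s.countable_toSet.exists_eq_range hne
  refine ⟨f, Set.eq_univ_of_univ_subset (hs.trans ?_)⟩
  refine Set.iUnion₂_subset fun c hc => ?_
  obtain ⟨n, rfl⟩ : c ∈ Set.range f := hf ▸ hc
  exact Set.subset_iUnion (fun n => (extChartAt (𝓡 p) (f n)).source) n

variable [IsManifold (𝓡 p) ∞ M]

/-- The coordinate vector field is the tangent map of the inverse chart, applied to a constant
vector. -/
theorem contMDiffOn_coordVec (c : M) (i : Fin p) :
    ContMDiffOn 𝓘(ℝ, Coord p) ((𝓡 p).prod 𝓘(ℝ, Coord p)) ∞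
      (fun x => (⟨(extChartAt (𝓡 p) c).symm x, coordVec c x i⟩ : TangentBundle (𝓡 p) M))
      (extChartAt (𝓡 p) c).target := by
  have hT : IsOpen (extChartAt (𝓡 p) c).target := isOpen_extChartAt_target c
  have h1 := (contMDiffOn_extChartAt_symm (I := 𝓡 p) (n := ∞) c).contMDiffOn_tangentMapWithin
    (m := ∞) (by simp) hT.uniqueMDiffOn
  have h2 : ContMDiff 𝓘(ℝ, Coord p) (𝓘(ℝ, Coord p).prod 𝓘(ℝ, Coord p)) ∞
      (fun x : Coord p =>
        (⟨x, EuclideanSpace.single i (1 : ℝ)⟩ : TangentBundle 𝓘(ℝ, Coord p) (Coord p))) := by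
    intro x
    exact contMDiffAt_vectorSpace_iff_contDiffAt.2 contDiffAt_const
  refine (h1.comp h2.contMDiffOn fun x hx => hx).congr fun x hx => ?_
  simp only [Function.comp, tangentMapWithin, coordVec]
  rw [mfderivWithin_of_isOpen hT hx]

/-- The tensor is the smooth section `g.inner` of the bundle of bilinear forms, evaluated at two
smooth coordinate vector fields. -/
theorem contDiffOn_metricTensor (g : RiemannianMetric p M) (c : M) (i j : Fin p) :
    ContDiffOn ℝ ∞ (fun x => metricTensor g c x i j) (extChartAt (𝓡 p) c).target := by
  intro x hx
  rw [← contMDiffWithinAt_iff_contDiffWithinAt]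
  have hb := contMDiffOn_extChartAt_symm (I := 𝓡 p) (n := ∞) c x hx
  have : ContMDiffWithinAt 𝓘(ℝ, Coord p) ((𝓡 p).prod 𝓘(ℝ)) ∞
      (fun x => Bundle.TotalSpace.mk' ℝ (E := Bundle.Trivial M ℝ)
        ((extChartAt (𝓡 p) c).symm x)
        (g.inner ((extChartAt (𝓡 p) c).symm x) (coordVec c x i) (coordVec c x j)))
      (extChartAt (𝓡 p) c).target x := by
    apply ContMDiffWithinAt.clm_bundle_apply₂ (F₁ := Coord p) (F₂ := Coord p)
    · exact ContMDiffAt.comp_contMDiffWithinAt x g.contMDiff.contMDiffAt hb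
    · exact contMDiffOn_coordVec c i x hx
    · exact contMDiffOn_coordVec c j x hx
  simp only [Bundle.contMDiffWithinAt_totalSpace] at this
  exact this.2

theorem contDiffOn_transition (c c' : M) :
    ContDiffOn ℝ ∞ (transition (p := p) c c') (overlap (p := p) c c') := by
  have := contDiffOn_ext_coord_change (I := 𝓡 p) (n := ∞) c' c
  rw [PartialEquiv.trans_source] at this
  exact this

theorem differentiableAt_transition {c c' : M} {x : Coord p} (hx : x ∈ overlap (p := p) c c') :
    DifferentiableAt ℝ (transition (p := p) c c') x :=
  ((contDiffOn_transition c c').differentiableOn (by simp)).differentiableAt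
    ((isOpen_overlap c c').mem_nhds hx)

theorem jacobian_mul_jacobian {c c' : M} {x : Coord p} (hx : x ∈ overlap (p := p) c c') :
    jacobian c' c (transition c c' x) * jacobian c c' x = 1 := by
  have h1 : (fderiv ℝ (transition c' c) (transition c c' x)).comp
      (fderiv ℝ (transition c c') x) = ContinuousLinearMap.id ℝ (Coord p) := by
    rw [← fderiv_comp x (differentiableAt_transition (transition_mem hx))
      (differentiableAt_transition hx)]
    rw [← fderiv_id (x := x)]
    apply Filter.EventuallyEq.fderiv_eq
    filter_upwards [(isOpen_overlap c c').mem_nhds hx] with y hy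
    exact transition_transition hy
  rw [jacobian_eq_toMatrix, jacobian_eq_toMatrix, ← LinearMap.toMatrix_comp,
    ← ContinuousLinearMap.toLinearMap_comp, h1]
  exact LinearMap.toMatrix_id _

/-- The derivative of the inverse of the chart around `c`, with the tangent spaces of `M` read as
the model space. -/
def frame (c : M) (x : Coord p) : Coord p →L[ℝ] Coord p :=
  mfderiv 𝓘(ℝ, Coord p) (𝓡 p) (extChartAt (𝓡 p) c).symm x

/-- The metric at the point `y`, with the tangent space at `y` read as the model space. -/
def metricForm (g : RiemannianMetric p M) (y : M) : Coord p →L[ℝ] Coord p →L[ℝ] ℝ :=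
  g.inner y

theorem metricTensor_apply (g : RiemannianMetric p M) (c : M) (x : Coord p) (i j : Fin p) :
    metricTensor g c x i j = metricForm g ((extChartAt (𝓡 p) c).symm x)
      (frame c x (EuclideanSpace.single i 1)) (frame c x (EuclideanSpace.single j 1)) :=
  rfl

/-- The chain rule for the inverse chart around `c`, which factors through the chart around `c'`. -/
theorem frame_transition {c c' : M} {x : Coord p} (hx : x ∈ overlap (p := p) c c') :
    frame c x = (frame c' (transition c c' x)).comp (fderiv ℝ (transition c c') x) := by
  have hd' : MDifferentiableAt 𝓘(ℝ, Coord p) (𝓡 p) (extChartAt (𝓡 p) c').symm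
      (transition c c' x) :=
    (contMDiffOn_extChartAt_symm (I := 𝓡 p) (n := ∞) c').contMDiffAt
      ((isOpen_extChartAt_target c').mem_nhds (transition_mem hx).1) |>.mdifferentiableAt (by simp)
  have h1 : mfderiv 𝓘(ℝ, Coord p) (𝓡 p) (extChartAt (𝓡 p) c).symm x =
      mfderiv 𝓘(ℝ, Coord p) (𝓡 p) ((extChartAt (𝓡 p) c').symm ∘ transition c c') x := by
    apply Filter.EventuallyEq.mfderiv_eq
    filter_upwards [(isOpen_overlap c c').mem_nhds hx] with y hy
    exact (symm_transition hy).symm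
  have h2 := mfderiv_comp x hd' (differentiableAt_transition hx).mdifferentiableAt
  rw [mfderiv_eq_fderiv] at h2
  exact h1.trans h2

/-- The transformation rule `G_c = Jᵀ G_{c'} J` of the metric tensor. -/
theorem metricTensor_transition (g : RiemannianMetric p M) {c c' : M} {x : Coord p}
    (hx : x ∈ overlap (p := p) c c') :
    metricTensor g c x =
      (jacobian c c' x)ᵀ * metricTensor g c' (transition c c' x) * jacobian c c' x := by
  ext i j
  rw [metricTensor_apply, ← symm_transition hx, frame_transition hx]
  simp only [ContinuousLinearMap.comp_apply, fderiv_transition_apply, map_sum, map_smul,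
    sum_apply, smul_apply, smul_eq_mul, Matrix.mul_apply,
    Matrix.transpose_apply, metricTensor_apply, Finset.mul_sum, Finset.sum_mul]
  refine Finset.sum_congr rfl fun k _ => Finset.sum_congr rfl fun l _ => ?_
  ring

theorem frame_injective (c : M) {x : Coord p} (hx : x ∈ (extChartAt (𝓡 p) c).target) :
    Function.Injective (frame c x) := by
  have h := mfderiv_extChartAt_comp_mfderivWithin_extChartAt_symm (I := 𝓡 p) hx
  simp only [ModelWithCorners.range_eq_univ, mfderivWithin_univ] at h
  set L : Coord p →L[ℝ] Coord p :=
    mfderiv (𝓡 p) 𝓘(ℝ, Coord p) (extChartAt (𝓡 p) c) ((extChartAt (𝓡 p) c).symm x) with hL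
  have h' : L.comp (frame c x) = ContinuousLinearMap.id ℝ (Coord p) := h
  intro v w hvw
  have := congrArg L hvw
  rwa [← ContinuousLinearMap.comp_apply, ← ContinuousLinearMap.comp_apply, h'] at this

theorem posDef_metricTensor (g : RiemannianMetric p M) (c : M) {x : Coord p}
    (hx : x ∈ (extChartAt (𝓡 p) c).target) : (metricTensor g c x).PosDef := by
  have hsymm : (metricTensor g c x).IsHermitian := by
    ext i j
    exact g.symm _ _ _
  refine Matrix.PosDef.of_dotProduct_mulVec_pos hsymm fun a ha => ?_
  set v : Coord p := WithLp.toLp 2 a with hv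
  have hv0 : v ≠ 0 := by
    intro h; apply ha; simpa [hv] using h
  have hDv : frame c x v ≠ 0 := by
    intro h
    exact hv0 (frame_injective c hx (h.trans (map_zero _).symm))
  have hsum : v = ∑ i, a i • EuclideanSpace.single i (1 : ℝ) := by
    ext l; simp [hv, Finset.sum_apply, Pi.single_apply]
  have hpos : 0 < metricForm g ((extChartAt (𝓡 p) c).symm x) (frame c x v) (frame c x v) :=
    g.pos ((extChartAt (𝓡 p) c).symm x) (frame c x v) hDv
  have heq : metricForm g ((extChartAt (𝓡 p) c).symm x) (frame c x v) (frame c x v)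
      = star a ⬝ᵥ metricTensor g c x *ᵥ a := by
    rw [hsum]
    simp only [map_sum, map_smul, sum_apply, smul_apply,
      smul_eq_mul, dotProduct, Matrix.mulVec, star_trivial, Finset.mul_sum, metricTensor_apply,
      Pi.star_apply]
    rw [Finset.sum_comm]
    refine Finset.sum_congr rfl fun k _ => Finset.sum_congr rfl fun l _ => ?_
    ring
  rw [← heq]
  exact hpos

end ChartCalculus

/-! ### The gradient inner product and the Laplace-Beltrami operator in charts -/

section Smoothness

theorem contDiffOn_det {E : Type*} [NormedAddCommGroup E] [NormedSpace ℝ E] {q : ℕ} {n : ℕ∞ω}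
    {s : Set E} {A : E → Matrix (Fin q) (Fin q) ℝ}
    (hA : ∀ i j, ContDiffOn ℝ n (fun x => A x i j) s) :
    ContDiffOn ℝ n (fun x => (A x).det) s := by
  simp only [Matrix.det_apply]
  refine ContDiffOn.sum fun σ _ => ContDiffOn.const_smul _ ?_
  exact contDiffOn_prod fun i _ => hA _ _

/-- By Cramer's rule each entry of the inverse is a quotient of determinants. -/
theorem contDiffOn_matrix_inv {E : Type*} [NormedAddCommGroup E] [NormedSpace ℝ E] {q : ℕ}
    {n : ℕ∞ω} {s : Set E} {A : E → Matrix (Fin q) (Fin q) ℝ}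
    (hA : ∀ i j, ContDiffOn ℝ n (fun x => A x i j) s) (h0 : ∀ x ∈ s, (A x).det ≠ 0)
    (i j : Fin q) : ContDiffOn ℝ n (fun x => (A x)⁻¹ i j) s := by
  have h : ∀ x, (A x)⁻¹ i j = ((A x).det)⁻¹ * ((A x).updateRow j (Pi.single i 1)).det := by
    intro x
    rw [Matrix.inv_def, Matrix.smul_apply, Matrix.adjugate_apply, Ring.inverse_eq_inv', smul_eq_mul]
  simp only [h]
  refine ((contDiffOn_det hA).inv h0).mul (contDiffOn_det fun k l => ?_)
  by_cases hk : k = j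
  · subst hk
    simp only [Matrix.updateRow_self]
    exact contDiffOn_const
  · simp only [Matrix.updateRow_ne hk]
    exact hA k l

theorem contDiffOn_partialDeriv {p : ℕ} {s : Set (Coord p)} (hs : IsOpen s) {n n' : ℕ∞ω}
    (hn : n' + 1 ≤ n) {f : Coord p → ℝ} (hf : ContDiffOn ℝ n f s) (i : Fin p) :
    ContDiffOn ℝ n' (partialDeriv i f) s :=
  (hf.fderiv_of_isOpen hs hn).clm_apply contDiffOn_const

end Smoothness

section ChartOperators

variable {p : ℕ} {M : Type u} [TopologicalSpace M] [ChartedSpace (Coord p) M]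
  [IsManifold (𝓡 p) ∞ M]

/-- The Riemannian volume density `(det G)^(1/2)` in the chart around `c`. -/
def volDensity (g : RiemannianMetric p M) (c : M) (x : Coord p) : ℝ :=
  √(metricTensor g c x).det

/-- The gradient inner product, computed in the chart around `c`. -/
def chartGrad (g : RiemannianMetric p M) (c : M) (u w : M → ℝ) (x : Coord p) : ℝ :=
  ∑ i, ∑ j, partialDeriv i (inCoord c u) x * (metricTensor g c x)⁻¹ i j *
    partialDeriv j (inCoord c w) x

/-- The Laplace-Beltrami operator, computed in the chart around `c`. -/
def chartLaplace (g : RiemannianMetric p M) (c : M) (u : M → ℝ) (x : Coord p) : ℝ :=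
  ∑ i, ∑ j, (volDensity g c x)⁻¹ *
    partialDeriv i (fun x => volDensity g c x * (metricTensor g c x)⁻¹ i j *
      partialDeriv j (inCoord c u) x) x

theorem gradInner_eq (g : RiemannianMetric p M) (u w : M → ℝ) (y : M) :
    gradInner g u w y = chartGrad g y u w (extChartAt (𝓡 p) y y) :=
  rfl

theorem det_metricTensor_pos (g : RiemannianMetric p M) (c : M) {x : Coord p}
    (hx : x ∈ (extChartAt (𝓡 p) c).target) : 0 < (metricTensor g c x).det :=
  (posDef_metricTensor g c hx).det_pos

theorem volDensity_pos (g : RiemannianMetric p M) (c : M) {x : Coord p}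
    (hx : x ∈ (extChartAt (𝓡 p) c).target) : 0 < volDensity g c x :=
  Real.sqrt_pos.2 (det_metricTensor_pos g c hx)

theorem volDensity_nonneg (g : RiemannianMetric p M) (c : M) (x : Coord p) :
    0 ≤ volDensity g c x :=
  Real.sqrt_nonneg _

theorem contDiffOn_volDensity (g : RiemannianMetric p M) (c : M) :
    ContDiffOn ℝ ∞ (volDensity g c) (extChartAt (𝓡 p) c).target :=
  (contDiffOn_det (contDiffOn_metricTensor g c)).sqrt fun _ hx => (det_metricTensor_pos g c hx).ne'

theorem contDiffOn_inv_metricTensor (g : RiemannianMetric p M) (c : M) (i j : Fin p) :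
    ContDiffOn ℝ ∞ (fun x => (metricTensor g c x)⁻¹ i j) (extChartAt (𝓡 p) c).target :=
  contDiffOn_matrix_inv (contDiffOn_metricTensor g c)
    (fun _ hx => (det_metricTensor_pos g c hx).ne') i j

theorem contDiffOn_inCoord {n : ℕ∞ω} (hn : n ≤ ∞) {u : M → ℝ}
    (hu : ContMDiff (𝓡 p) 𝓘(ℝ, ℝ) n u) (c : M) :
    ContDiffOn ℝ n (inCoord c u) (extChartAt (𝓡 p) c).target :=
  contMDiffOn_iff_contDiffOn.1
    (hu.comp_contMDiffOn ((contMDiffOn_extChartAt_symm (I := 𝓡 p) (n := ∞) c).of_le hn))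

theorem continuousOn_partialDeriv_inCoord {u : M → ℝ} (hu : ContMDiff (𝓡 p) 𝓘(ℝ, ℝ) 1 u) (c : M)
    (i : Fin p) :
    ContinuousOn (partialDeriv i (inCoord c u)) (extChartAt (𝓡 p) c).target :=
  (contDiffOn_partialDeriv (n' := 0) (isOpen_extChartAt_target c) (by simp)
    (contDiffOn_inCoord (by simp) hu c) i).continuousOn

theorem differentiableAt_inCoord {u : M → ℝ} (hu : ContMDiff (𝓡 p) 𝓘(ℝ, ℝ) 1 u) (c : M)
    {x : Coord p} (hx : x ∈ (extChartAt (𝓡 p) c).target) :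
    DifferentiableAt ℝ (inCoord c u) x :=
  ((contDiffOn_inCoord (by simp) hu c).differentiableOn (by simp)).differentiableAt
    ((isOpen_extChartAt_target c).mem_nhds hx)

theorem continuousOn_chartGrad (g : RiemannianMetric p M) (c : M) {u w : M → ℝ}
    (hu : ContMDiff (𝓡 p) 𝓘(ℝ, ℝ) 1 u) (hw : ContMDiff (𝓡 p) 𝓘(ℝ, ℝ) 1 w) :
    ContinuousOn (chartGrad g c u w) (extChartAt (𝓡 p) c).target :=
  continuousOn_finsetSum _ fun i _ => continuousOn_finsetSum _ fun j _ =>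
    ((continuousOn_partialDeriv_inCoord hu c i).mul
      (contDiffOn_inv_metricTensor g c i j).continuousOn).mul
      (continuousOn_partialDeriv_inCoord hw c j)

/-- The coefficients of the flux `(det G)^(1/2) G⁻¹ ∇u`, whose divergence is
`(det G)^(1/2) Δu`. -/
theorem contDiffOn_flux (g : RiemannianMetric p M) (c : M) {u : M → ℝ}
    (hu : ContMDiff (𝓡 p) 𝓘(ℝ, ℝ) 2 u) (i j : Fin p) :
    ContDiffOn ℝ 1 (fun x => volDensity g c x * (metricTensor g c x)⁻¹ i j *
      partialDeriv j (inCoord c u) x) (extChartAt (𝓡 p) c).target :=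
  (((contDiffOn_volDensity g c).of_le (by simp)).mul
    ((contDiffOn_inv_metricTensor g c i j).of_le (by simp))).mul
    (contDiffOn_partialDeriv (n := 2) (isOpen_extChartAt_target c) (by norm_num)
      (contDiffOn_inCoord (WithTop.coe_le_coe.2 (le_top (a := (2 : ℕ∞)))) hu c) j)

theorem continuousOn_chartLaplace (g : RiemannianMetric p M) (c : M) {u : M → ℝ}
    (hu : ContMDiff (𝓡 p) 𝓘(ℝ, ℝ) 2 u) :
    ContinuousOn (chartLaplace g c u) (extChartAt (𝓡 p) c).target :=
  continuousOn_finsetSum _ fun i _ => continuousOn_finsetSum _ fun j _ =>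
    ((contDiffOn_volDensity g c).continuousOn.inv₀ fun _ hx => (volDensity_pos g c hx).ne').mul
      (contDiffOn_partialDeriv (n' := 0) (isOpen_extChartAt_target c) (by simp)
        (contDiffOn_flux g c hu i j) i).continuousOn

/-- The chain rule for the gradient under a change of charts. -/
theorem partialDeriv_inCoord_transition {u : M → ℝ} (hu : ContMDiff (𝓡 p) 𝓘(ℝ, ℝ) 1 u)
    {c c' : M} {x : Coord p} (hx : x ∈ overlap (p := p) c c') (i : Fin p) :
    partialDeriv i (inCoord c u) x =
      ∑ k, jacobian c c' x k i * partialDeriv k (inCoord c' u) (transition c c' x) := by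
  have h : fderiv ℝ (inCoord c u) x =
      (fderiv ℝ (inCoord c' u) (transition c c' x)).comp (fderiv ℝ (transition c c') x) := by
    rw [← fderiv_comp x (differentiableAt_inCoord hu c' (transition_mem hx).1)
      (differentiableAt_transition hx)]
    apply Filter.EventuallyEq.fderiv_eq
    filter_upwards [(isOpen_overlap c c').mem_nhds hx] with y hy
    simp only [inCoord, Function.comp]
    rw [symm_transition hy]
  rw [partialDeriv, h, ContinuousLinearMap.comp_apply, fderiv_transition_apply, map_sum]
  simp only [map_smul, smul_eq_mul, partialDeriv]

theorem chartGrad_eq_dotProduct (g : RiemannianMetric p M) (c : M) (u w : M → ℝ) (x : Coord p) :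
    chartGrad g c u w x = (fun i => partialDeriv i (inCoord c u) x) ⬝ᵥ
      (metricTensor g c x)⁻¹ *ᵥ fun j => partialDeriv j (inCoord c w) x := by
  simp only [chartGrad, dotProduct, Matrix.mulVec, Finset.mul_sum, mul_assoc]

/-- The gradient inner product does not depend on the chart: gradients transform with `Jᵀ` and
`G⁻¹` with `J⁻¹` and its transpose. -/
theorem chartGrad_transition (g : RiemannianMetric p M) {u w : M → ℝ}
    (hu : ContMDiff (𝓡 p) 𝓘(ℝ, ℝ) 1 u) (hw : ContMDiff (𝓡 p) 𝓘(ℝ, ℝ) 1 w)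
    {c c' : M} {x : Coord p} (hx : x ∈ overlap (p := p) c c') :
    chartGrad g c u w x = chartGrad g c' u w (transition c c' x) := by
  have hv : ∀ {v : M → ℝ}, ContMDiff (𝓡 p) 𝓘(ℝ, ℝ) 1 v →
      (fun i => partialDeriv i (inCoord c v) x) =
        (jacobian c c' x)ᵀ *ᵥ fun k => partialDeriv k (inCoord c' v) (transition c c' x) := by
    intro v hv
    ext i
    simp only [partialDeriv_inCoord_transition hv hx, Matrix.mulVec, dotProduct,
      Matrix.transpose_apply]
  have hJ := jacobian_mul_jacobian hx
  set J := jacobian c c' x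
  set K := jacobian c' c (transition c c' x)
  have hJ' : J * K = 1 := mul_eq_one_comm.1 hJ
  have hT : (Jᵀ)⁻¹ = Kᵀ :=
    Matrix.inv_eq_left_inv (by rw [← Matrix.transpose_mul, hJ', Matrix.transpose_one])
  have hinv : (metricTensor g c x)⁻¹ = K * (metricTensor g c' (transition c c' x))⁻¹ * Kᵀ := by
    rw [metricTensor_transition g hx, Matrix.mul_inv_rev, Matrix.mul_inv_rev,
      Matrix.inv_eq_left_inv hJ, hT, mul_assoc]
  rw [chartGrad_eq_dotProduct, chartGrad_eq_dotProduct, hv hu, hv hw, hinv, Matrix.mulVec_mulVec,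
    mul_assoc, ← Matrix.transpose_mul, hJ', Matrix.transpose_one, mul_one,
    Matrix.mulVec_transpose, ← Matrix.dotProduct_mulVec, Matrix.mulVec_mulVec, ← mul_assoc, hJ',
    one_mul]

/-- The transformation rule that makes the chart volumes agree on overlaps. -/
theorem volDensity_transition (g : RiemannianMetric p M) {c c' : M} {x : Coord p}
    (hx : x ∈ overlap (p := p) c c') :
    volDensity g c x =
      |(fderiv ℝ (transition c c') x).det| * volDensity g c' (transition c c' x) := by
  rw [volDensity, volDensity, metricTensor_transition g hx, Matrix.det_mul, Matrix.det_mul,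
    Matrix.det_transpose, det_fderiv_transition, ← Real.sqrt_sq_eq_abs, ← Real.sqrt_mul (sq_nonneg _)]
  congr 1
  ring

theorem gradInner_eq_chartGrad (g : RiemannianMetric p M) {u w : M → ℝ}
    (hu : ContMDiff (𝓡 p) 𝓘(ℝ, ℝ) 1 u) (hw : ContMDiff (𝓡 p) 𝓘(ℝ, ℝ) 1 w) {c y : M}
    (hy : y ∈ (extChartAt (𝓡 p) c).source) :
    gradInner g u w y = chartGrad g c u w (extChartAt (𝓡 p) c y) := by
  have hx : extChartAt (𝓡 p) y y ∈ overlap (p := p) y c :=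
    ⟨mem_extChartAt_target y, by simpa using hy⟩
  rw [gradInner_eq, chartGrad_transition g hu hw hx, transition, extChartAt_to_inv]

theorem continuous_gradInner (g : RiemannianMetric p M) {u w : M → ℝ}
    (hu : ContMDiff (𝓡 p) 𝓘(ℝ, ℝ) 1 u) (hw : ContMDiff (𝓡 p) 𝓘(ℝ, ℝ) 1 w) :
    Continuous (gradInner g u w) := by
  refine continuous_iff_continuousAt.2 fun y => ?_
  have hU := (isOpen_extChartAt_source (I := 𝓡 p) y).mem_nhds (mem_extChartAt_source y)
  have h : ContinuousOn (chartGrad g y u w ∘ extChartAt (𝓡 p) y) (extChartAt (𝓡 p) y).source :=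
    (continuousOn_chartGrad g y hu hw).comp (continuousOn_extChartAt y)
      (extChartAt (𝓡 p) y).mapsTo
  refine (h.continuousAt hU).congr ?_
  filter_upwards [hU] with z hz
  exact (gradInner_eq_chartGrad g hu hw hz).symm

end ChartOperators

/-! ### The Riemannian measure in charts -/

section Volume

variable {p : ℕ} {M : Type u} [TopologicalSpace M] [ChartedSpace (Coord p) M]
  [IsManifold (𝓡 p) ∞ M]

theorem aemeasurable_volDensity (g : RiemannianMetric p M) (c : M) :
    AEMeasurable (volDensity g c) (volume.restrict (extChartAt (𝓡 p) c).target) :=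
  (contDiffOn_volDensity g c).continuousOn.aemeasurable (measurableSet_target c)

variable [MeasurableSpace M]

theorem chartVolume_eq (g : RiemannianMetric p M) (c : M) :
    chartVolume g c = (((volume : Measure (Coord p)).restrict (extChartAt (𝓡 p) c).target).withDensity
      fun x => ENNReal.ofReal (volDensity g c x)).map (extChartAt (𝓡 p) c).symm :=
  rfl

variable [BorelSpace M]

theorem chartVolume_apply (g : RiemannianMetric p M) (c : M) {A : Set M} (hA : MeasurableSet A) :
    chartVolume g c A =
      ∫⁻ x in (extChartAt (𝓡 p) c).target ∩ (extChartAt (𝓡 p) c).symm ⁻¹' A,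
        ENNReal.ofReal (volDensity g c x) := by
  have hm := measurableSet_target_inter_preimage (p := p) c hA
  have hN : NullMeasurableSet ((extChartAt (𝓡 p) c).symm ⁻¹' A)
      (volume.restrict (extChartAt (𝓡 p) c).target) :=
    (aemeasurable_extChartAt_symm c).nullMeasurable hA
  rw [chartVolume_eq, Measure.map_apply_of_aemeasurable
    ((aemeasurable_extChartAt_symm c).mono_ac (withDensity_absolutelyContinuous _ _)) hA,
    withDensity_apply₀ _ hN, Measure.restrict_restrict₀ hN, Set.inter_comm]

/-- The charts define the same measure on their common domain, by the change of variables formula. -/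
theorem chartVolume_eq_of_subset (g : RiemannianMetric p M) {c c' : M} {A : Set M}
    (hA : MeasurableSet A) (hc : A ⊆ (extChartAt (𝓡 p) c).source)
    (hc' : A ⊆ (extChartAt (𝓡 p) c').source) :
    chartVolume g c A = chartVolume g c' A := by
  set B := (extChartAt (𝓡 p) c).target ∩ (extChartAt (𝓡 p) c).symm ⁻¹' A with hB
  have hBo : B ⊆ overlap (p := p) c c' := fun x hx => ⟨hx.1, hc' hx.2⟩
  have him : transition c c' '' B =
      (extChartAt (𝓡 p) c').target ∩ (extChartAt (𝓡 p) c').symm ⁻¹' A := by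
    rw [hB, image_extChartAt_inter_source, image_extChartAt_inter_source,
      Set.inter_eq_right.2 hc, Set.inter_eq_right.2 hc', Set.image_image]
    refine Set.image_congr fun y hy => ?_
    rw [transition, (extChartAt (𝓡 p) c).left_inv (hc hy)]
  have hBm : MeasurableSet B := measurableSet_target_inter_preimage c hA
  rw [chartVolume_apply g c hA, chartVolume_apply g c' hA, ← him,
    lintegral_image_eq_lintegral_abs_det_fderiv_mul volume hBm
      (fun x hx => (differentiableAt_transition (hBo hx)).hasFDerivAt.hasFDerivWithinAt)
      ((transition_injOn c c').mono hBo)]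
  refine setLIntegral_congr_fun hBm fun x hx => ?_
  rw [volDensity_transition g (hBo hx), ENNReal.ofReal_mul (abs_nonneg _)]

theorem chartVolume_inter_source (g : RiemannianMetric p M) (c : M) {A : Set M}
    (hA : MeasurableSet A) :
    chartVolume g c (A ∩ (extChartAt (𝓡 p) c).source) = chartVolume g c A := by
  rw [chartVolume_apply g c hA,
    chartVolume_apply g c (hA.inter (isOpen_extChartAt_source c).measurableSet)]
  congr 2
  ext x
  simp only [Set.mem_inter_iff, Set.mem_preimage]
  exact ⟨fun h => ⟨h.1, h.2.1⟩, fun h => ⟨h.1, h.2, (extChartAt (𝓡 p) c).map_target h.1⟩⟩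

/-- In the domain of a chart the uniform measure is `(det G(x))^(1/2) dx`. Cutting `M` into
countably many measurable pieces, each inside one chart, and gluing the chart volumes of the pieces
gives an upper bound of all chart volumes that has this property. -/
theorem uniformMeasure_apply_of_subset [CompactSpace M] (g : RiemannianMetric p M) {c : M}
    {A : Set M} (hA : MeasurableSet A) (hc : A ⊆ (extChartAt (𝓡 p) c).source) :
    uniformMeasure g A = chartVolume g c A := by
  have : Nonempty M := ⟨c⟩
  obtain ⟨f, hf⟩ := exists_seq_chart_cover (p := p) (M := M)
  set U : ℕ → Set M := fun n => (extChartAt (𝓡 p) (f n)).source with hU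
  have hUm : ∀ n, MeasurableSet (disjointed U n) :=
    MeasurableSet.disjointed fun n => (isOpen_extChartAt_source (f n)).measurableSet
  set ν : Measure M := Measure.sum fun n => (chartVolume g (f n)).restrict (disjointed U n) with hν
  have key : ∀ (c : M) {A : Set M}, MeasurableSet A → A ⊆ (extChartAt (𝓡 p) c).source →
      ν A = chartVolume g c A := by
    intro c A hA hc
    rw [hν, Measure.sum_apply _ hA]
    have : ∀ n, (chartVolume g (f n)).restrict (disjointed U n) A =
        chartVolume g c (A ∩ disjointed U n) := by
      intro n
      rw [Measure.restrict_apply hA]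
      exact chartVolume_eq_of_subset g (hA.inter (hUm n))
        (Set.inter_subset_right.trans (disjointed_subset U n)) (Set.inter_subset_left.trans hc)
    simp only [this]
    rw [← measure_iUnion (fun i j hij => ((disjoint_disjointed U hij).mono
      Set.inter_subset_right Set.inter_subset_right)) (fun n => hA.inter (hUm n)),
      ← Set.inter_iUnion, iUnion_disjointed, hf, Set.inter_univ]
  have hle : uniformMeasure g ≤ ν := by
    refine iSup_le fun c' => Measure.le_iff.2 fun B hB => ?_
    rw [← chartVolume_inter_source g c' hB, ← key c'
      (hB.inter (isOpen_extChartAt_source c').measurableSet) Set.inter_subset_right]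
    exact measure_mono Set.inter_subset_left
  refine le_antisymm ((hle A).trans_eq (key c hA hc)) ?_
  exact le_iSup (fun c : M => chartVolume g c) c A

theorem restrict_uniformMeasure [CompactSpace M] (g : RiemannianMetric p M) (c : M) :
    (uniformMeasure g).restrict (extChartAt (𝓡 p) c).source = chartVolume g c := by
  ext A hA
  rw [Measure.restrict_apply hA, uniformMeasure_apply_of_subset g
    (hA.inter (isOpen_extChartAt_source c).measurableSet) Set.inter_subset_right,
    chartVolume_inter_source g c hA]

/-- The measure is locally finite because the volume density is bounded on compact parts of a
chart. -/
theorem isFiniteMeasure_uniformMeasure [CompactSpace M] (g : RiemannianMetric p M) :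
    IsFiniteMeasure (uniformMeasure g) := by
  have : IsLocallyFiniteMeasure (uniformMeasure g) := by
    refine ⟨fun y => ?_⟩
    have hT : (extChartAt (𝓡 p) y).target ∈ 𝓝 (extChartAt (𝓡 p) y y) :=
      extChartAt_target_mem_nhds y
    obtain ⟨K, hK, hKT, hKc⟩ := local_compact_nhds hT
    have hN : (extChartAt (𝓡 p) y).source ∩ extChartAt (𝓡 p) y ⁻¹' interior K ∈ 𝓝 y :=
      Filter.inter_mem (extChartAt_source_mem_nhds y)
        ((continuousAt_extChartAt y).preimage_mem_nhds (interior_mem_nhds.2 hK))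
    have hNo : IsOpen ((extChartAt (𝓡 p) y).source ∩ extChartAt (𝓡 p) y ⁻¹' interior K) :=
      (continuousOn_extChartAt y).isOpen_inter_preimage (isOpen_extChartAt_source y) isOpen_interior
    refine ⟨_, hN, ?_⟩
    rw [uniformMeasure_apply_of_subset g hNo.measurableSet Set.inter_subset_left,
      chartVolume_apply g y hNo.measurableSet]
    have hsub : (extChartAt (𝓡 p) y).target ∩ (extChartAt (𝓡 p) y).symm ⁻¹'
        ((extChartAt (𝓡 p) y).source ∩ extChartAt (𝓡 p) y ⁻¹' interior K) ⊆ K := by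
      rintro x ⟨hx, -, hx2⟩
      rw [Set.mem_preimage, (extChartAt (𝓡 p) y).right_inv hx] at hx2
      exact interior_subset hx2
    refine (lintegral_mono_set hsub).trans_lt ?_
    have hint : IntegrableOn (volDensity g y) K :=
      ((contDiffOn_volDensity g y).continuousOn.mono hKT).integrableOn_compact hKc
    exact hint.lintegral_lt_top
  exact CompactSpace.isFiniteMeasure

theorem isOpenPosMeasure_uniformMeasure [CompactSpace M] (g : RiemannianMetric p M) :
    (uniformMeasure g).IsOpenPosMeasure := by
  refine ⟨fun U hU ⟨y, hy⟩ h0 => ?_⟩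
  have hV : IsOpen (U ∩ (extChartAt (𝓡 p) y).source) := hU.inter (isOpen_extChartAt_source y)
  have h1 := measure_mono_null (Set.inter_subset_left (t := (extChartAt (𝓡 p) y).source)) h0
  rw [uniformMeasure_apply_of_subset g hV.measurableSet Set.inter_subset_right,
    chartVolume_apply g y hV.measurableSet] at h1
  have hW : IsOpen ((extChartAt (𝓡 p) y).target ∩
      (extChartAt (𝓡 p) y).symm ⁻¹' (U ∩ (extChartAt (𝓡 p) y).source)) :=
    (continuousOn_extChartAt_symm y).isOpen_inter_preimage (isOpen_extChartAt_target y) hV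
  have hmem : extChartAt (𝓡 p) y y ∈ (extChartAt (𝓡 p) y).target ∩
      (extChartAt (𝓡 p) y).symm ⁻¹' (U ∩ (extChartAt (𝓡 p) y).source) :=
    ⟨mem_extChartAt_target y, by simpa using hy⟩
  have hpos := hW.measure_pos volume ⟨_, hmem⟩
  rw [lintegral_eq_zero_iff' (((aemeasurable_volDensity g y).mono_set
    Set.inter_subset_left).ennreal_ofReal)] at h1
  have h2 : ∀ᵐ x ∂(volume.restrict ((extChartAt (𝓡 p) y).target ∩
      (extChartAt (𝓡 p) y).symm ⁻¹' (U ∩ (extChartAt (𝓡 p) y).source))), False := by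
    filter_upwards [h1, ae_restrict_mem hW.measurableSet] with x hx hxW
    have := volDensity_pos g y hxW.1
    simp only [Pi.zero_apply, ENNReal.ofReal_eq_zero] at hx
    linarith
  rw [ae_iff] at h2
  simp only [not_false_eq_true, Set.ofPred_true, Measure.restrict_apply_univ] at h2
  exact hpos.ne' h2

/-- Integration in a chart. -/
theorem integral_uniformMeasure_eq [CompactSpace M] (g : RiemannianMetric p M) (c : M) {f : M → ℝ}
    (hf : ContinuousOn f (extChartAt (𝓡 p) c).source)
    (h0 : ∀ y, y ∉ (extChartAt (𝓡 p) c).source → f y = 0) :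
    ∫ y, f y ∂(uniformMeasure g) =
      ∫ x in (extChartAt (𝓡 p) c).target, volDensity g c x * inCoord c f x := by
  have hae : AEStronglyMeasurable f (chartVolume g c) := by
    rw [← restrict_uniformMeasure]
    exact (hf.aemeasurable (isOpen_extChartAt_source c).measurableSet).aestronglyMeasurable
  have hψ : AEMeasurable (extChartAt (𝓡 p) c).symm
      ((volume.restrict (extChartAt (𝓡 p) c).target).withDensity
        fun x => ENNReal.ofReal (volDensity g c x)) :=
    (aemeasurable_extChartAt_symm c).mono_ac (withDensity_absolutelyContinuous _ _)
  rw [← setIntegral_eq_integral_of_forall_compl_eq_zero h0, restrict_uniformMeasure]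
  rw [chartVolume_eq] at hae ⊢
  rw [integral_map hψ hae]
  have := integral_withDensity_eq_integral_toReal_smul₀
    (μ := volume.restrict (extChartAt (𝓡 p) c).target)
    (aemeasurable_volDensity g c).ennreal_ofReal (ae_of_all _ fun _ => ENNReal.ofReal_lt_top)
    (inCoord c f)
  refine this.trans ?_
  refine integral_congr_ae (ae_of_all _ fun x => ?_)
  simp only [smul_eq_mul]
  rw [ENNReal.toReal_ofReal (volDensity_nonneg g c x)]

end Volume

/-! ### Green's formula in a chart and independence of the chart -/

section IntegrationByParts

/-- Integration by parts on an open set `T` against a function `h` that vanishes outside a compact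
part `K` of `T`. -/
theorem setIntegral_mul_partialDeriv {p : ℕ} {T K : Set (Coord p)} (hT : IsOpen T)
    (hK : IsCompact K) (hKT : K ⊆ T) {h F : Coord p → ℝ} (hh : ContDiffOn ℝ 1 h T)
    (hF : ContDiffOn ℝ 1 F T) (h0 : ∀ x ∈ T, x ∉ K → h x = 0) (i : Fin p) :
    IntegrableOn (fun x => h x * partialDeriv i F x) T ∧
      IntegrableOn (fun x => partialDeriv i h x * F x) T ∧
      ∫ x in T, h x * partialDeriv i F x = -∫ x in T, partialDeriv i h x * F x := by
  -- `k` extends `h` by zero to a differentiable function on the whole space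
  set k : Coord p → ℝ := T.indicator h with hk
  have hkT : ∀ x ∈ T, k =ᶠ[𝓝 x] h := fun x hx => by
    filter_upwards [hT.mem_nhds hx] with y hy
    exact Set.indicator_of_mem hy h
  have hk0 : ∀ x, x ∉ K → k x = 0 := fun x hx => by
    by_cases hxT : x ∈ T
    · rw [hk, Set.indicator_of_mem hxT, h0 x hxT hx]
    · exact Set.indicator_of_notMem hxT h
  have hkK : ∀ x, x ∉ K → k =ᶠ[𝓝 x] fun _ => 0 := fun x hx => by
    filter_upwards [hK.isClosed.isOpen_compl.mem_nhds hx] with y hy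
    exact hk0 y hy
  have hkd : ∀ x, DifferentiableAt ℝ k x := fun x => by
    by_cases hxT : x ∈ T
    · exact (hkT x hxT).differentiableAt_iff.2
        ((hh.differentiableOn (by simp)).differentiableAt (hT.mem_nhds hxT))
    · exact (hkK x fun hx => hxT (hKT hx)).differentiableAt_iff.2 (differentiableAt_const _)
  have hFd : ∀ x ∈ T, DifferentiableAt ℝ F x := fun x hx =>
    (hF.differentiableOn (by simp)).differentiableAt (hT.mem_nhds hx)
  have hkp : ∀ x ∈ T, partialDeriv i k x = partialDeriv i h x := fun x hx => by
    rw [partialDeriv, (hkT x hx).fderiv_eq, partialDeriv]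
  have hkp0 : ∀ x, x ∉ K → partialDeriv i k x = 0 := fun x hx => by
    rw [partialDeriv, (hkK x hx).fderiv_eq]
    simp
  have hint : ∀ a : Coord p → ℝ, ContinuousOn a T → (∀ x, x ∉ K → a x = 0) → Integrable a :=
    fun a ha h0 => (integrableOn_iff_integrable_of_support_subset
      (Function.support_subset_iff'.2 h0)).1 ((ha.mono hKT).integrableOn_compact hK)
  have hcF : ContinuousOn (partialDeriv i F) T :=
    (contDiffOn_partialDeriv (n' := 0) hT (by simp) hF i).continuousOn
  have hch : ContinuousOn (partialDeriv i h) T :=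
    (contDiffOn_partialDeriv (n' := 0) hT (by simp) hh i).continuousOn
  have hck : ContinuousOn k T := hh.continuousOn.congr fun x hx => Set.indicator_of_mem hx h
  have hckp : ContinuousOn (partialDeriv i k) T := hch.congr hkp
  have e1 : Set.EqOn (fun x => k x * partialDeriv i F x) (fun x => h x * partialDeriv i F x) T :=
    fun x hx => by simp only [hk, Set.indicator_of_mem hx]
  have e2 : Set.EqOn (fun x => partialDeriv i k x * F x) (fun x => partialDeriv i h x * F x) T :=
    fun x hx => by simp only [hkp x hx]
  have i1 : Integrable (fun x => k x * partialDeriv i F x) :=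
    hint _ (hck.mul hcF) fun x hx => by rw [hk0 x hx, zero_mul]
  have i2 : Integrable (fun x => partialDeriv i k x * F x) :=
    hint _ (hckp.mul hF.continuousOn) fun x hx => by rw [hkp0 x hx, zero_mul]
  have i3 : Integrable (fun x => k x * F x) :=
    hint _ (hck.mul hF.continuousOn) fun x hx => by rw [hk0 x hx, zero_mul]
  have hts : tsupport k ⊆ K := closure_minimal (Function.support_subset_iff'.2 hk0) hK.isClosed
  have key : ∫ x, k x * partialDeriv i F x = -∫ x, partialDeriv i k x * F x :=
    integral_mul_fderiv_eq_neg_fderiv_mul_of_integrable i2 i1 i3 (fun x _ => hkd x)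
      fun x hx => hFd x (hKT (hts hx))
  refine ⟨i1.integrableOn.congr_fun e1 hT.measurableSet,
    i2.integrableOn.congr_fun e2 hT.measurableSet, ?_⟩
  rw [← setIntegral_congr_fun hT.measurableSet e1, ← setIntegral_congr_fun hT.measurableSet e2,
    setIntegral_eq_integral_of_forall_compl_eq_zero, setIntegral_eq_integral_of_forall_compl_eq_zero,
    key]
  · intro x hx
    rw [hkp0 x fun h => hx (hKT h), zero_mul]
  · intro x hx
    rw [hk0 x fun h => hx (hKT h), zero_mul]

end IntegrationByParts

section Green

variable {p : ℕ} {M : Type u} [TopologicalSpace M] [ChartedSpace (Coord p) M]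
  [IsManifold (𝓡 p) ∞ M]

theorem gradInner_eq_zero_of_notMem_tsupport (g : RiemannianMetric p M) {φ : M → ℝ} (u : M → ℝ)
    {y : M} (hy : y ∉ tsupport φ) : gradInner g φ u y = 0 := by
  have h : inCoord y φ =ᶠ[𝓝 (extChartAt (𝓡 p) y y)] fun _ => 0 := by
    have hc := continuousAt_extChartAt_symm (I := 𝓡 p) y
    have hV : (tsupport φ)ᶜ ∈ 𝓝 ((extChartAt (𝓡 p) y).symm (extChartAt (𝓡 p) y y)) := by
      rw [extChartAt_to_inv]
      exact (isClosed_tsupport φ).isOpen_compl.mem_nhds hy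
    filter_upwards [hc.preimage_mem_nhds hV] with x hx
    exact image_eq_zero_of_notMem_tsupport (f := φ) hx
  rw [gradInner_eq, chartGrad]
  have h0 : ∀ i, partialDeriv i (inCoord y φ) (extChartAt (𝓡 p) y y) = 0 := fun i => by
    rw [partialDeriv, h.fderiv_eq]
    simp
  simp only [h0, zero_mul, Finset.sum_const_zero]

theorem continuousOn_chartLaplace_comp (g : RiemannianMetric p M) (c : M) {u : M → ℝ}
    (hu : ContMDiff (𝓡 p) 𝓘(ℝ, ℝ) 2 u) :
    ContinuousOn (fun y => chartLaplace g c u (extChartAt (𝓡 p) c y))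
      (extChartAt (𝓡 p) c).source :=
  (continuousOn_chartLaplace g c hu).comp (continuousOn_extChartAt c) (extChartAt (𝓡 p) c).mapsTo

variable [MeasurableSpace M] [BorelSpace M] [CompactSpace M]

/-- Green's formula in one chart, with the Laplace-Beltrami operator computed in that chart. -/
theorem integral_mul_chartLaplace (g : RiemannianMetric p M) (c : M) {φ u : M → ℝ}
    (hφ : ContMDiff (𝓡 p) 𝓘(ℝ, ℝ) 1 φ) (hs : tsupport φ ⊆ (extChartAt (𝓡 p) c).source)
    (hu : ContMDiff (𝓡 p) 𝓘(ℝ, ℝ) 2 u) :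
    ∫ y, φ y * chartLaplace g c u (extChartAt (𝓡 p) c y) ∂(uniformMeasure g) =
      -∫ y, gradInner g φ u y ∂(uniformMeasure g) := by
  have hu1 : ContMDiff (𝓡 p) 𝓘(ℝ, ℝ) 1 u := hu.of_le (by norm_num)
  set T := (extChartAt (𝓡 p) c).target with hTdef
  have hT : IsOpen T := isOpen_extChartAt_target c
  set K := extChartAt (𝓡 p) c '' tsupport φ with hKdef
  have hK : IsCompact K :=
    (isClosed_tsupport φ).isCompact.image_of_continuousOn ((continuousOn_extChartAt c).mono hs)
  have hKT : K ⊆ T := by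
    rintro _ ⟨y, hy, rfl⟩
    exact (extChartAt (𝓡 p) c).map_source (hs hy)
  have h0 : ∀ x ∈ T, x ∉ K → inCoord c φ x = 0 := fun x hx hxK => by
    refine image_eq_zero_of_notMem_tsupport (f := φ) fun h => hxK ?_
    exact ⟨_, h, (extChartAt (𝓡 p) c).right_inv hx⟩
  set F : Fin p → Fin p → Coord p → ℝ := fun i j x =>
    volDensity g c x * (metricTensor g c x)⁻¹ i j * partialDeriv j (inCoord c u) x with hF
  have hparts := fun i j => setIntegral_mul_partialDeriv hT hK hKT
    (contDiffOn_inCoord (by simp) hφ c) (contDiffOn_flux g c hu i j) h0 i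
  have hL : ∫ y, φ y * chartLaplace g c u (extChartAt (𝓡 p) c y) ∂(uniformMeasure g) =
      ∫ x in T, ∑ i, ∑ j, inCoord c φ x * partialDeriv i (F i j) x := by
    rw [integral_uniformMeasure_eq g c]
    · refine setIntegral_congr_fun hT.measurableSet fun x hx => ?_
      have hv := (volDensity_pos g c hx).ne'
      simp only [inCoord, chartLaplace, (extChartAt (𝓡 p) c).right_inv hx, Finset.mul_sum]
      refine Finset.sum_congr rfl fun i _ => Finset.sum_congr rfl fun j _ => ?_
      field_simp
      rfl
    · exact hφ.continuous.continuousOn.mul ((continuousOn_chartLaplace g c hu).comp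
        (continuousOn_extChartAt c) (extChartAt (𝓡 p) c).mapsTo)
    · intro y hy
      rw [image_eq_zero_of_notMem_tsupport fun h => hy (hs h), zero_mul]
  have hR : ∫ y, gradInner g φ u y ∂(uniformMeasure g) =
      ∫ x in T, ∑ i, ∑ j, partialDeriv i (inCoord c φ) x * F i j x := by
    rw [integral_uniformMeasure_eq g c (continuous_gradInner g hφ hu1).continuousOn
      fun y hy => gradInner_eq_zero_of_notMem_tsupport g u fun h => hy (hs h)]
    refine setIntegral_congr_fun hT.measurableSet fun x hx => ?_
    simp only [inCoord]
    rw [gradInner_eq_chartGrad g hφ hu1 ((extChartAt (𝓡 p) c).map_target hx),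
      (extChartAt (𝓡 p) c).right_inv hx, chartGrad, Finset.mul_sum]
    refine Finset.sum_congr rfl fun i _ => ?_
    rw [Finset.mul_sum]
    refine Finset.sum_congr rfl fun j _ => ?_
    simp only [hF]
    ring
  rw [hL, hR, integral_finsetSum _ fun i _ => integrable_finsetSum _ fun j _ => (hparts i j).1,
    integral_finsetSum _ fun i _ => integrable_finsetSum _ fun j _ => (hparts i j).2.1,
    ← Finset.sum_neg_distrib]
  refine Finset.sum_congr rfl fun i _ => ?_
  rw [integral_finsetSum _ fun j _ => (hparts i j).1,
    integral_finsetSum _ fun j _ => (hparts i j).2.1, ← Finset.sum_neg_distrib]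
  exact Finset.sum_congr rfl fun j _ => (hparts i j).2.2

variable [T2Space M]

/-- The Laplace-Beltrami operator does not depend on the chart. By Green's formula the operators
computed in two charts have the same integrals against all test functions supported in the common
domain, since the gradient inner product and the measure do not depend on the chart. -/
theorem chartLaplace_eq_chartLaplace (g : RiemannianMetric p M) {u : M → ℝ}
    (hu : ContMDiff (𝓡 p) 𝓘(ℝ, ℝ) 2 u) {c c' y : M} (hc : y ∈ (extChartAt (𝓡 p) c).source)
    (hc' : y ∈ (extChartAt (𝓡 p) c').source) :
    chartLaplace g c u (extChartAt (𝓡 p) c y) = chartLaplace g c' u (extChartAt (𝓡 p) c' y) := by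
  have := isFiniteMeasure_uniformMeasure g
  have := isOpenPosMeasure_uniformMeasure g
  set U := (extChartAt (𝓡 p) c).source ∩ (extChartAt (𝓡 p) c').source with hU
  have hUo : IsOpen U := (isOpen_extChartAt_source c).inter (isOpen_extChartAt_source c')
  have h1 := (continuousOn_chartLaplace_comp g c hu).mono (Set.inter_subset_left : U ⊆ _)
  have h2 := (continuousOn_chartLaplace_comp g c' hu).mono (Set.inter_subset_right : U ⊆ _)
  have hint : ∀ (φ f : M → ℝ), Continuous φ → tsupport φ ⊆ U → ContinuousOn f U →
      Integrable (fun y => φ y * f y) (uniformMeasure g) := fun φ f hφ hs hf => by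
    have hcont : Continuous fun y => φ y * f y := by
      refine continuous_iff_continuousAt.2 fun y => ?_
      by_cases hy : y ∈ tsupport φ
      · exact hφ.continuousAt.mul (hf.continuousAt (hUo.mem_nhds (hs hy)))
      · refine continuousAt_const.congr (f := fun _ => 0) ?_
        filter_upwards [(isClosed_tsupport φ).isOpen_compl.mem_nhds hy] with z hz
        rw [image_eq_zero_of_notMem_tsupport hz, zero_mul]
    exact hcont.integrable_of_hasCompactSupport (HasCompactSupport.of_compactSpace _)
  have hsec : SecondCountableTopology M := ChartedSpace.secondCountable_of_sigmaCompact (Coord p) M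
  have key : ∀ᵐ y ∂(uniformMeasure g), y ∈ U →
      chartLaplace g c u (extChartAt (𝓡 p) c y) - chartLaplace g c' u (extChartAt (𝓡 p) c' y) = 0 := by
    refine hUo.ae_eq_zero_of_integral_contMDiff_smul_eq_zero (𝓡 p)
      ((h1.sub h2).locallyIntegrableOn hUo.measurableSet) fun φ hφ _ hs => ?_
    have hφ1 : ContMDiff (𝓡 p) 𝓘(ℝ, ℝ) 1 φ := hφ.of_le (by simp)
    simp only [smul_eq_mul, mul_sub]
    rw [integral_sub (hint φ _ hφ.continuous hs h1) (hint φ _ hφ.continuous hs h2),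
      integral_mul_chartLaplace g c hφ1 (hs.trans Set.inter_subset_left) hu,
      integral_mul_chartLaplace g c' hφ1 (hs.trans Set.inter_subset_right) hu, sub_self]
  have hEq := Measure.eqOn_open_of_ae_eq (μ := uniformMeasure g)
    (f := fun y => chartLaplace g c u (extChartAt (𝓡 p) c y))
    (g := fun y => chartLaplace g c' u (extChartAt (𝓡 p) c' y)) (U := U)
    ((ae_restrict_iff' hUo.measurableSet).2 (key.mono fun y hy hyU => sub_eq_zero.1 (hy hyU)))
    hUo h1 h2
  exact hEq ⟨hc, hc'⟩

theorem laplaceBeltrami_eq_chartLaplace (g : RiemannianMetric p M) {u : M → ℝ}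
    (hu : ContMDiff (𝓡 p) 𝓘(ℝ, ℝ) 2 u) {c y : M} (hy : y ∈ (extChartAt (𝓡 p) c).source) :
    laplaceBeltrami g u y = chartLaplace g c u (extChartAt (𝓡 p) c y) :=
  chartLaplace_eq_chartLaplace g hu (mem_extChartAt_source y) hy

theorem continuous_laplaceBeltrami (g : RiemannianMetric p M) {u : M → ℝ}
    (hu : ContMDiff (𝓡 p) 𝓘(ℝ, ℝ) 2 u) : Continuous (laplaceBeltrami g u) := by
  refine continuous_iff_continuousAt.2 fun y => ?_
  have hU := (isOpen_extChartAt_source (I := 𝓡 p) y).mem_nhds (mem_extChartAt_source y)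
  refine ((continuousOn_chartLaplace_comp g y hu).continuousAt hU).congr ?_
  filter_upwards [hU] with z hz
  exact (laplaceBeltrami_eq_chartLaplace g hu hz).symm

end Green

/-! ### Calculus of the gradient inner product and the global Green formula -/

section GradientCalculus

variable {p : ℕ} {M : Type u} [TopologicalSpace M] [ChartedSpace (Coord p) M]
  [IsManifold (𝓡 p) ∞ M]

theorem differentiableAt_inCoord_self {u : M → ℝ} (hu : ContMDiff (𝓡 p) 𝓘(ℝ, ℝ) 1 u) (y : M) :
    DifferentiableAt ℝ (inCoord y u) (extChartAt (𝓡 p) y y) :=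
  differentiableAt_inCoord hu y (mem_extChartAt_target y)

theorem gradInner_comm (g : RiemannianMetric p M) (u w : M → ℝ) (y : M) :
    gradInner g u w y = gradInner g w u y := by
  have hs := (posDef_metricTensor g y (mem_extChartAt_target y)).inv.isHermitian
  simp only [gradInner]
  rw [Finset.sum_comm]
  refine Finset.sum_congr rfl fun i _ => Finset.sum_congr rfl fun j _ => ?_
  have := hs.apply i j
  simp only [star_trivial] at this
  rw [this]
  ring

theorem gradInner_sum_left (g : RiemannianMetric p M) {ι : Type*} (s : Finset ι) {u : ι → M → ℝ}
    (hu : ∀ a ∈ s, ContMDiff (𝓡 p) 𝓘(ℝ, ℝ) 1 (u a)) (r : ι → ℝ) (w : M → ℝ) (y : M) :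
    gradInner g (fun z => ∑ a ∈ s, r a * u a z) w y = ∑ a ∈ s, r a * gradInner g (u a) w y := by
  have h : ∀ i, partialDeriv i (inCoord y fun z => ∑ a ∈ s, r a * u a z) (extChartAt (𝓡 p) y y) =
      ∑ a ∈ s, r a * partialDeriv i (inCoord y (u a)) (extChartAt (𝓡 p) y y) := fun i => by
    have : (inCoord y fun z => ∑ a ∈ s, r a * u a z) =
        fun x : Coord p => ∑ a ∈ s, r a * inCoord y (u a) x := rfl
    rw [partialDeriv, this, fderiv_fun_sum fun a ha =>
      (differentiableAt_inCoord_self (hu a ha) y).const_mul (r a), sum_apply]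
    refine Finset.sum_congr rfl fun a ha => ?_
    rw [fderiv_const_mul (differentiableAt_inCoord_self (hu a ha) y), smul_apply, smul_eq_mul,
      partialDeriv]
  simp only [gradInner, h, Finset.sum_mul, Finset.mul_sum]
  refine (Finset.sum_congr rfl fun i _ => Finset.sum_comm).trans (Finset.sum_comm.trans ?_)
  refine Finset.sum_congr rfl fun a _ => ?_
  refine Finset.sum_congr rfl fun i _ => Finset.sum_congr rfl fun j _ => ?_
  ring

theorem gradInner_mul_left (g : RiemannianMetric p M) {u v : M → ℝ}
    (hu : ContMDiff (𝓡 p) 𝓘(ℝ, ℝ) 1 u) (hv : ContMDiff (𝓡 p) 𝓘(ℝ, ℝ) 1 v) (w : M → ℝ) (y : M) :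
    gradInner g (fun z => u z * v z) w y = u y * gradInner g v w y + v y * gradInner g u w y := by
  have h : ∀ i, partialDeriv i (inCoord y fun z => u z * v z) (extChartAt (𝓡 p) y y) =
      u y * partialDeriv i (inCoord y v) (extChartAt (𝓡 p) y y) +
        v y * partialDeriv i (inCoord y u) (extChartAt (𝓡 p) y y) := fun i => by
    have : (inCoord y fun z => u z * v z) = fun x : Coord p => inCoord y u x * inCoord y v x := rfl
    rw [partialDeriv, this, fderiv_fun_mul (differentiableAt_inCoord_self hu y)
      (differentiableAt_inCoord_self hv y), inCoord_self, inCoord_self]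
    rfl
  simp only [gradInner, h, Finset.mul_sum, ← Finset.sum_add_distrib]
  refine Finset.sum_congr rfl fun i _ => Finset.sum_congr rfl fun j _ => ?_
  ring

theorem gradInner_exp_left (g : RiemannianMetric p M) {u : M → ℝ}
    (hu : ContMDiff (𝓡 p) 𝓘(ℝ, ℝ) 1 u) (w : M → ℝ) (y : M) :
    gradInner g (fun z => Real.exp (u z)) w y = Real.exp (u y) * gradInner g u w y := by
  have h : ∀ i, partialDeriv i (inCoord y fun z => Real.exp (u z)) (extChartAt (𝓡 p) y y) =
      Real.exp (u y) * partialDeriv i (inCoord y u) (extChartAt (𝓡 p) y y) := fun i => by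
    have : (inCoord y fun z => Real.exp (u z)) = fun x : Coord p => Real.exp (inCoord y u x) := rfl
    rw [partialDeriv, this, fderiv_exp (differentiableAt_inCoord_self hu y), inCoord_self]
    rfl
  simp only [gradInner, h, Finset.mul_sum]
  refine Finset.sum_congr rfl fun i _ => Finset.sum_congr rfl fun j _ => ?_
  ring

theorem gradInner_self_nonneg (g : RiemannianMetric p M) (u : M → ℝ) (y : M) :
    0 ≤ gradInner g u u y := by
  rw [gradInner_eq, chartGrad_eq_dotProduct]
  have := (posDef_metricTensor g y (mem_extChartAt_target y)).inv.posSemidef.dotProduct_mulVec_nonneg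
    fun i => partialDeriv i (inCoord y u) (extChartAt (𝓡 p) y y)
  simpa only [star_trivial] using this

theorem fderiv_inCoord_eq_zero (g : RiemannianMetric p M) {u : M → ℝ} {c : M} {x : Coord p}
    (hx : x ∈ (extChartAt (𝓡 p) c).target) (h : chartGrad g c u u x = 0) :
    fderiv ℝ (inCoord c u) x = 0 := by
  rw [chartGrad_eq_dotProduct] at h
  set a : Fin p → ℝ := fun i => partialDeriv i (inCoord c u) x with ha
  have ha0 : a = 0 := by
    by_contra hne
    have := (posDef_metricTensor g c hx).inv.dotProduct_mulVec_pos hne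
    rw [star_trivial] at this
    exact this.ne' h
  refine ContinuousLinearMap.coe_injective
    ((EuclideanSpace.basisFun (Fin p) ℝ).toBasis.ext fun i => ?_)
  have := congrFun ha0 i
  simpa [ha, partialDeriv] using this

/-- On a connected manifold a function with vanishing gradient is constant. -/
theorem eq_of_gradInner_self_eq_zero [ConnectedSpace M] (g : RiemannianMetric p M) {u : M → ℝ}
    (hu : ContMDiff (𝓡 p) 𝓘(ℝ, ℝ) 1 u) (h : ∀ y, gradInner g u u y = 0) (y z : M) : u y = u z := by
  refine IsLocallyConstant.apply_eq_of_preconnectedSpace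
    ((IsLocallyConstant.iff_eventually_eq u).2 fun c => ?_) y z
  have hT := isOpen_extChartAt_target (I := 𝓡 p) c
  obtain ⟨ε, hε, hball⟩ := Metric.isOpen_iff.1 hT _ (mem_extChartAt_target c)
  have hB : extChartAt (𝓡 p) c ⁻¹' Metric.ball (extChartAt (𝓡 p) c c) ε ∈ 𝓝 c :=
    (continuousAt_extChartAt c).preimage_mem_nhds (Metric.ball_mem_nhds _ hε)
  filter_upwards [hB, extChartAt_source_mem_nhds (I := 𝓡 p) c] with z hz hzc
  have hconst := Metric.isOpen_ball.is_const_of_fderiv_eq_zero (𝕜 := ℝ) (f := inCoord c u)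
    (s := Metric.ball (extChartAt (𝓡 p) c c) ε) (convex_ball _ _).isPreconnected
    (fun x hx => (differentiableAt_inCoord hu c (hball hx)).differentiableWithinAt)
    (fun x hx => fderiv_inCoord_eq_zero g (hball hx) (by
      rw [← (extChartAt (𝓡 p) c).right_inv (hball hx),
        ← gradInner_eq_chartGrad g hu hu ((extChartAt (𝓡 p) c).map_target (hball hx))]
      exact h _))
    hz (Metric.mem_ball_self hε)
  simpa only [inCoord, (extChartAt (𝓡 p) c).left_inv hzc, extChartAt_to_inv] using hconst

theorem gradInner_const_left (g : RiemannianMetric p M) (c : ℝ) (w : M → ℝ) (y : M) :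
    gradInner g (fun _ => c) w y = 0 := by
  have h : ∀ i, partialDeriv i (inCoord y fun _ : M => c) (extChartAt (𝓡 p) y y) = 0 := fun i => by
    have : (inCoord y fun _ : M => c) = fun _ : Coord p => c := rfl
    rw [partialDeriv, this]
    simp
  simp only [gradInner, h, zero_mul, Finset.sum_const_zero]

variable [MeasurableSpace M] [BorelSpace M] [CompactSpace M] [T2Space M]

/-- Green's formula on the closed manifold `M`. -/
theorem integral_mul_laplaceBeltrami (g : RiemannianMetric p M) {v u : M → ℝ}
    (hv : ContMDiff (𝓡 p) 𝓘(ℝ, ℝ) 1 v) (hu : ContMDiff (𝓡 p) 𝓘(ℝ, ℝ) 2 u) :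
    ∫ y, v y * laplaceBeltrami g u y ∂(uniformMeasure g) =
      -∫ y, gradInner g v u y ∂(uniformMeasure g) := by
  have := isFiniteMeasure_uniformMeasure g
  have hu1 : ContMDiff (𝓡 p) 𝓘(ℝ, ℝ) 1 u := hu.of_le (by norm_num)
  obtain ⟨ρ, hρ⟩ := SmoothPartitionOfUnity.exists_isSubordinate_chartAt_source (𝓡 p) M
  have hfin : {i | (Function.support (ρ i)).Nonempty}.Finite :=
    ρ.locallyFinite.finite_nonempty_of_compact
  set I := hfin.toFinset with hI
  have hsum : ∀ y, ∑ i ∈ I, ρ i y = 1 := fun y => by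
    rw [← ρ.sum_eq_one (Set.mem_univ y)]
    refine (finsum_eq_sum_of_support_subset _ fun i hi => ?_).symm
    rw [hI, Set.Finite.coe_toFinset]
    exact ⟨y, hi⟩
  have hρ1 : ∀ i, ContMDiff (𝓡 p) 𝓘(ℝ, ℝ) 1 (fun y => ρ i y) := fun i =>
    (ρ i).contMDiff.of_le (by simp)
  have hρv : ∀ i, ContMDiff (𝓡 p) 𝓘(ℝ, ℝ) 1 (fun y => ρ i y * v y) := fun i => (hρ1 i).mul hv
  have hint : ∀ {f : M → ℝ}, Continuous f → Integrable f (uniformMeasure g) := fun hf =>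
    hf.integrable_of_hasCompactSupport (HasCompactSupport.of_compactSpace _)
  have hLc := continuous_laplaceBeltrami g hu
  have hloc : ∀ i, ∫ y, ρ i y * v y * laplaceBeltrami g u y ∂(uniformMeasure g) =
      -∫ y, gradInner g (fun y => ρ i y * v y) u y ∂(uniformMeasure g) := fun i => by
    have hs : tsupport (fun y => ρ i y * v y) ⊆ (extChartAt (𝓡 p) i).source := by
      refine (closure_mono (Function.support_mul_subset_left _ _)).trans ?_
      rw [extChartAt_source]
      exact hρ i
    rw [← integral_mul_chartLaplace g i (hρv i) hs hu]
    refine integral_congr_ae (ae_of_all _ fun y => ?_)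
    by_cases hy : y ∈ (extChartAt (𝓡 p) i).source
    · simp only
      rw [laplaceBeltrami_eq_chartLaplace g hu hy]
    · have h0 : ρ i y * v y = 0 :=
        image_eq_zero_of_notMem_tsupport (f := fun y => ρ i y * v y) fun h => hy (hs h)
      simp only [h0, zero_mul]
  have h1 : ∀ y, v y * laplaceBeltrami g u y =
      ∑ i ∈ I, ρ i y * v y * laplaceBeltrami g u y := fun y => by
    rw [← Finset.sum_mul, ← Finset.sum_mul, hsum, one_mul]
  have h2 : ∀ y, gradInner g v u y = ∑ i ∈ I, gradInner g (fun y => ρ i y * v y) u y := fun y => by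
    have hv' : v = fun z => ∑ i ∈ I, 1 * (ρ i z * v z) := by
      ext z
      simp only [one_mul]
      rw [← Finset.sum_mul, hsum, one_mul]
    conv_lhs => rw [hv']
    rw [gradInner_sum_left g I (fun i _ => hρv i)]
    simp only [one_mul]
  simp only [h1, h2]
  rw [integral_finsetSum (f := fun i y => ρ i y * v y * laplaceBeltrami g u y) _
      fun i _ => hint (((hρv i).continuous).mul hLc),
    integral_finsetSum _ fun i _ => hint (continuous_gradInner g (hρv i) hu1),
    ← Finset.sum_neg_distrib]
  exact Finset.sum_congr rfl fun i _ => hloc i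

end GradientCalculus

/-! ### Second moments and limit theorems for averages -/

section SecondMoment

variable {M : Type u} [MeasurableSpace M] {m : ℕ} {ν : Measure M}

/-- The matrix `E[ψ_a ψ_b]` of second moments. -/
def secondMoment (ν : Measure M) (ψ : Fin m → M → ℝ) : Matrix (Fin m) (Fin m) ℝ :=
  Matrix.of fun a b => ∫ y, ψ a y * ψ b y ∂ν

theorem integrable_sum_mul_sum {ψ χ : Fin m → M → ℝ} (h : ∀ a b, Integrable (fun y => ψ a y * χ b y) ν)
    (r q : Fin m → ℝ) : Integrable (fun y => (∑ a, r a * ψ a y) * ∑ b, q b * χ b y) ν := by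
  simp only [Finset.sum_mul_sum]
  refine integrable_finsetSum _ fun a _ => integrable_finsetSum _ fun b _ => ?_
  refine ((h a b).const_mul (r a * q b)).congr (ae_of_all _ fun y => ?_)
  simp only
  ring

theorem integral_sum_mul_sum {ψ χ : Fin m → M → ℝ} (h : ∀ a b, Integrable (fun y => ψ a y * χ b y) ν)
    (r q : Fin m → ℝ) :
    ∫ y, (∑ a, r a * ψ a y) * ∑ b, q b * χ b y ∂ν =
      ∑ a, ∑ b, r a * q b * ∫ y, ψ a y * χ b y ∂ν := by
  simp only [Finset.sum_mul_sum]
  have h' : ∀ a b, Integrable (fun y => r a * ψ a y * (q b * χ b y)) ν := fun a b =>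
    ((h a b).const_mul (r a * q b)).congr (ae_of_all _ fun y => by simp only; ring)
  rw [integral_finsetSum _ fun a _ => integrable_finsetSum _ fun b _ => h' a b]
  refine Finset.sum_congr rfl fun a _ => ?_
  rw [integral_finsetSum _ fun b _ => h' a b]
  refine Finset.sum_congr rfl fun b _ => ?_
  rw [← integral_const_mul]
  refine integral_congr_ae (ae_of_all _ fun y => ?_)
  simp only
  ring

theorem dotProduct_secondMoment {ψ : Fin m → M → ℝ}
    (h : ∀ a b, Integrable (fun y => ψ a y * ψ b y) ν) (r : Fin m → ℝ) :
    r ⬝ᵥ secondMoment ν ψ *ᵥ r = ∫ y, (∑ a, r a * ψ a y) ^ 2 ∂ν := by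
  simp only [pow_two]
  rw [integral_sum_mul_sum h]
  simp only [dotProduct, Matrix.mulVec, Finset.mul_sum, secondMoment, Matrix.of_apply]
  refine Finset.sum_congr rfl fun a _ => Finset.sum_congr rfl fun b _ => ?_
  ring

theorem isHermitian_secondMoment (ν : Measure M) (ψ : Fin m → M → ℝ) :
    (secondMoment ν ψ).IsHermitian := by
  ext a b
  simp [secondMoment, mul_comm]

theorem posSemidef_secondMoment {ψ : Fin m → M → ℝ}
    (h : ∀ a b, Integrable (fun y => ψ a y * ψ b y) ν) : (secondMoment ν ψ).PosSemidef := by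
  refine Matrix.PosSemidef.of_dotProduct_mulVec_nonneg (isHermitian_secondMoment ν ψ) fun r => ?_
  rw [star_trivial, dotProduct_secondMoment h]
  exact integral_nonneg fun y => sq_nonneg _

end SecondMoment

section LimitTheorems

variable {M : Type u} [MeasurableSpace M] {ν : Measure M} {S : Type v} [MeasurableSpace S]
  {P : Measure S} {X : ℕ → S → M}

theorem identDistrib_comp_of_hasLaw (hX : ∀ h, HasLaw (X h) ν P) {E : Type*} [MeasurableSpace E]
    {f : M → E} (hf : Measurable f) (h k : ℕ) :
    IdentDistrib (fun s => f (X h s)) (fun s => f (X k s)) P P :=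
  (IdentDistrib.mk (hX h).aemeasurable (hX k).aemeasurable
    ((hX h).map_eq.trans (hX k).map_eq.symm)).comp hf

theorem tendsto_sampleMean (hX : ∀ h, HasLaw (X h) ν P) (hind : iIndepFun X P) {f : M → ℝ}
    (hf : Measurable f) (hint : Integrable f ν) :
    ∀ᵐ s ∂P, Tendsto (fun n : ℕ => (n : ℝ)⁻¹ * ∑ h ∈ Finset.range n, f (X h s)) atTop
      (𝓝 (∫ y, f y ∂ν)) := by
  have hi : Integrable (fun s => f (X 0 s)) P := by
    have := (integrable_map_measure (f := X 0) (g := f) (μ := P)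
      hf.aestronglyMeasurable (hX 0).aemeasurable).1 ((hX 0).map_eq.symm ▸ hint)
    exact this
  have h := strong_law_ae_real (fun k s => f (X k s)) hi
    (fun i j hij => (hind.indepFun hij).comp hf hf)
    fun k => identDistrib_comp_of_hasLaw hX hf k 0
  have he : ∫ s, f (X 0 s) ∂P = ∫ y, f y ∂ν :=
    (hX 0).integral_comp hf.aestronglyMeasurable
  filter_upwards [h] with s hs
  rw [he] at hs
  refine hs.congr fun n => ?_
  rw [div_eq_inv_mul]

variable [IsProbabilityMeasure P] {m : ℕ}

/-- The central limit theorem for centred random vectors, by Lévy's theorem and the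
one-dimensional central limit theorem for the linear forms of the vectors. -/
theorem tendstoInDistribution_sum_vector (hX : ∀ h, HasLaw (X h) ν P) (hind : iIndepFun X P)
    {ψ : Fin m → M → ℝ} (hψ : ∀ a, Measurable (ψ a)) (hL2 : ∀ a, MemLp (ψ a) 2 ν)
    (h0 : ∀ a, ∫ y, ψ a y ∂ν = 0) :
    TendstoInDistribution
      (fun (n : ℕ) s => (WithLp.toLp 2 fun a => (√(n : ℝ))⁻¹ * ∑ h ∈ Finset.range n, ψ a (X h s) :
        EuclideanSpace ℝ (Fin m)))
      atTop (id : EuclideanSpace ℝ (Fin m) → EuclideanSpace ℝ (Fin m))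
      (fun _ => P) (multivariateGaussian 0 (secondMoment ν ψ)) := by
  have hνP : IsProbabilityMeasure ν := (hX 0).isProbabilityMeasure_iff.1 inferInstance
  have hprod : ∀ a b, Integrable (fun y => ψ a y * ψ b y) ν := fun a b =>
    (hL2 a).integrable_mul (hL2 b)
  have hS := posSemidef_secondMoment hprod
  have hmeas : ∀ n : ℕ, AEMeasurable (fun s => (WithLp.toLp 2 fun a =>
      (√(n : ℝ))⁻¹ * ∑ h ∈ Finset.range n, ψ a (X h s) : EuclideanSpace ℝ (Fin m))) P := fun n => by
    refine (WithLp.measurable_toLp 2 (Fin m → ℝ)).comp_aemeasurable (aemeasurable_pi_lambda _ fun a => ?_)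
    exact (Finset.aemeasurable_fun_sum _ fun h _ =>
      (hψ a).comp_aemeasurable (hX h).aemeasurable).const_mul _
  refine ⟨hmeas, aemeasurable_id, ?_⟩
  refine ProbabilityMeasure.tendsto_iff_tendsto_charFun.2 fun r => ?_
  set f : M → ℝ := fun y => ∑ a, r a * ψ a y with hf
  have hfm : Measurable f := Finset.measurable_fun_sum _ fun a _ => (hψ a).const_mul _
  have hfL : MemLp f 2 ν := memLp_finsetSum _ fun a _ => (hL2 a).const_mul _
  have hf0 : ∫ y, f y ∂ν = 0 := by
    rw [hf, integral_finsetSum _ fun a _ => ((hL2 a).integrable (by norm_num)).const_mul _]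
    simp [integral_const_mul, h0]
  have hf2 : ∫ y, f y ^ 2 ∂ν = r ⬝ᵥ secondMoment ν ψ *ᵥ r := (dotProduct_secondMoment hprod r).symm
  have hlaw0 : ∫ s, f (X 0 s) ∂P = 0 := by
    rw [← hf0]
    exact (hX 0).integral_comp hfm.aestronglyMeasurable
  have hXL : MemLp (fun s => f (X 0 s)) 2 P := by
    have h1 : MemLp f 2 (P.map (X 0)) := (hX 0).map_eq.symm ▸ hfL
    exact (memLp_map_measure_iff hfm.aestronglyMeasurable (hX 0).aemeasurable).1 h1
  have hvar : Var[fun s => f (X 0 s); P] = r ⬝ᵥ secondMoment ν ψ *ᵥ r := by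
    rw [variance_of_integral_eq_zero (X := fun s => f (X 0 s))
      (hfm.comp_aemeasurable (hX 0).aemeasurable) hlaw0, ← hf2]
    exact (hX 0).integral_comp (f := fun y => f y ^ 2) (hfm.pow_const 2).aestronglyMeasurable
  have hclt := tendstoInDistribution_inv_sqrt_mul_sum_sub (P := P) (X := fun k s => f (X k s))
    (Y := id) (P' := gaussianReal 0 Var[fun s => f (X 0 s); P].toNNReal) HasLaw.id hXL
    (hind.comp (fun _ => f) fun _ => hfm) fun k => identDistrib_comp_of_hasLaw hX hfm k 0
  have hc := ProbabilityMeasure.tendsto_iff_tendsto_charFun.1 hclt.tendsto 1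
  simp only [ProbabilityMeasure.coe_mk, Measure.map_id] at hc ⊢
  have hlim : charFun (multivariateGaussian 0 (secondMoment ν ψ)) r =
      charFun (gaussianReal 0 Var[fun s => f (X 0 s); P].toNNReal) 1 := by
    rw [charFun_multivariateGaussian hS, charFun_gaussianReal, hvar,
      Real.coe_toNNReal _ (by rw [← hf2]; exact integral_nonneg fun y => sq_nonneg _)]
    simp
  rw [hlim]
  refine hc.congr fun n => ?_
  have hm1 : AEMeasurable (fun s => (√(n : ℝ))⁻¹ *
      (∑ k ∈ Finset.range n, f (X k s) - n * ∫ s, f (X 0 s) ∂P)) P := hclt.forall_aemeasurable n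
  rw [charFun_apply, charFun_apply, integral_map hm1 (by fun_prop),
    integral_map (hmeas n) (by fun_prop)]
  refine integral_congr_ae (ae_of_all _ fun s => ?_)
  simp only
  congr 3
  rw [hlaw0, mul_zero, sub_zero]
  simp only [hf, PiLp.inner_apply, Finset.mul_sum, RCLike.inner_apply, conj_trivial, one_mul]
  rw [Finset.sum_comm]
  refine Finset.sum_congr rfl fun a _ => Finset.sum_congr rfl fun k _ => ?_
  ring

end LimitTheorems

/-! ### Asymptotics of linear estimating equations -/

section LinearEstimatingEquation

variable {M : Type u} {m : ℕ}

/-- The average over the data of a matrix of functions. -/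
def empMatrix (w : Fin m → Fin m → M → ℝ) (n : ℕ) (x : ℕ → M) : Matrix (Fin m) (Fin m) ℝ :=
  Matrix.of fun a b => (n : ℝ)⁻¹ * ∑ h ∈ Finset.range n, w a b (x h)

/-- The average over the data of a vector of functions. -/
def empVector (d : Fin m → M → ℝ) (n : ℕ) (x : ℕ → M) : Fin m → ℝ :=
  fun a => (n : ℝ)⁻¹ * ∑ h ∈ Finset.range n, d a (x h)

/-- The solution of the linear estimating equation `W_n π = d_n`. The inverse of a singular matrix is
the zero matrix, so the value is `0` where `W_n` is singular. -/
def empSolution (w : Fin m → Fin m → M → ℝ) (d : Fin m → M → ℝ) (n : ℕ) (x : ℕ → M) :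
    EuclideanSpace ℝ (Fin m) :=
  WithLp.toLp 2 ((empMatrix w n x)⁻¹ *ᵥ empVector d n x)

theorem posSemidef_empMatrix {w : Fin m → Fin m → M → ℝ}
    (hw : ∀ y, (Matrix.of fun a b => w a b y).PosSemidef) (n : ℕ) (x : ℕ → M) :
    (empMatrix w n x).PosSemidef := by
  have h : empMatrix w n x =
      (n : ℝ)⁻¹ • ∑ h ∈ Finset.range n, Matrix.of fun a b => w a b (x h) := by
    ext a b
    simp [empMatrix, Matrix.sum_apply]
  rw [h]
  exact (Matrix.posSemidef_sum _ fun k _ => hw (x k)).smul (by positivity)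

theorem empVector_eq {w : Fin m → Fin m → M → ℝ} {d ψ : Fin m → M → ℝ}
    {W : Matrix (Fin m) (Fin m) ℝ} {π₀ : Fin m → ℝ}
    (hd : ∀ a y, d a y = ∑ b, w a b y * π₀ b + ∑ b, W a b * ψ b y) (n : ℕ) (x : ℕ → M) :
    empVector d n x = empMatrix w n x *ᵥ π₀ + W *ᵥ empVector ψ n x := by
  ext a
  simp only [empVector, hd, empMatrix, Pi.add_apply, Matrix.mulVec, dotProduct, Matrix.of_apply,
    Finset.sum_add_distrib, mul_add]
  congr 1
  · rw [Finset.sum_comm, Finset.mul_sum]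
    refine Finset.sum_congr rfl fun b _ => ?_
    rw [← Finset.sum_mul, mul_assoc]
  · rw [Finset.sum_comm, Finset.mul_sum]
    refine Finset.sum_congr rfl fun b _ => ?_
    rw [← Finset.mul_sum]
    ring

/-- The scaled error of the estimator is a matrix close to `1` times the normalized sum of the
influence functions, plus a remainder that vanishes as soon as `W_n` is invertible. -/
theorem sqrt_smul_empSolution_sub {w : Fin m → Fin m → M → ℝ} {d ψ : Fin m → M → ℝ}
    {W : Matrix (Fin m) (Fin m) ℝ} {π₀ : EuclideanSpace ℝ (Fin m)}
    (hd : ∀ a y, d a y = ∑ b, w a b y * π₀ b + ∑ b, W a b * ψ b y) (n : ℕ) (x : ℕ → M) :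
    √(n : ℝ) • (empSolution w d n x - π₀) =
      WithLp.toLp 2 (((empMatrix w n x)⁻¹ * W) *ᵥ
        fun a => (√(n : ℝ))⁻¹ * ∑ h ∈ Finset.range n, ψ a (x h)) +
      WithLp.toLp 2 (√(n : ℝ) • (((empMatrix w n x)⁻¹ * empMatrix w n x - 1) *ᵥ π₀)) := by
  have h1 : (fun a => (√(n : ℝ))⁻¹ * ∑ h ∈ Finset.range n, ψ a (x h)) =
      √(n : ℝ) • empVector ψ n x := by
    ext a
    rw [Pi.smul_apply, empVector, smul_eq_mul, ← mul_assoc, ← div_eq_mul_inv, Real.sqrt_div_self]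
  rw [h1, empSolution, empVector_eq hd, Matrix.mulVec_smul, WithLp.toLp_smul, WithLp.toLp_smul,
    ← smul_add]
  congr 1
  ext a
  simp only [PiLp.sub_apply, PiLp.add_apply, Matrix.mulVec_add, Matrix.mulVec_mulVec,
    Matrix.sub_mulVec, Matrix.one_mulVec, Pi.add_apply, Pi.sub_apply]
  ring

/-- Measurability holds on all matrices, singular ones included, since Cramer's rule with
`0⁻¹ = 0` agrees with the convention for the inverse of a singular matrix. -/
theorem measurable_matrix_inv_apply (a b : Fin m) :
    Measurable fun A : Fin m → Fin m → ℝ => (Matrix.of A)⁻¹ a b := by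
  have h : ∀ A : Fin m → Fin m → ℝ, (Matrix.of A)⁻¹ a b =
      ((Matrix.of A).det)⁻¹ * ((Matrix.of A).updateRow b (Pi.single a 1)).det := by
    intro A
    rw [Matrix.inv_def, Matrix.smul_apply, Matrix.adjugate_apply, Ring.inverse_eq_inv', smul_eq_mul]
  simp only [h]
  have h1 : Continuous fun A : Fin m → Fin m → ℝ => (Matrix.of A).det :=
    Continuous.matrix_det continuous_id
  have h2 : Continuous fun A : Fin m → Fin m → ℝ =>
      ((Matrix.of A).updateRow b (Pi.single a 1)).det :=
    Continuous.matrix_det (Continuous.matrix_updateRow b continuous_id continuous_const)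
  exact h1.measurable.inv.mul h2.measurable

variable [MeasurableSpace M] {ν : Measure M} {S : Type v} [MeasurableSpace S]
  {P : Measure S} {X : ℕ → S → M}

theorem aemeasurable_empMatrix_apply (hX : ∀ h, AEMeasurable (X h) P)
    {w : Fin m → Fin m → M → ℝ} (hw : ∀ a b, Measurable (w a b)) (n : ℕ) (a b : Fin m) :
    AEMeasurable (fun s => empMatrix w n (fun h => X h s) a b) P :=
  (Finset.aemeasurable_fun_sum _ fun h _ => (hw a b).comp_aemeasurable (hX h)).const_mul _

theorem aemeasurable_empMatrix_inv_apply (hX : ∀ h, AEMeasurable (X h) P)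
    {w : Fin m → Fin m → M → ℝ} (hw : ∀ a b, Measurable (w a b)) (n : ℕ) (a b : Fin m) :
    AEMeasurable (fun s => (empMatrix w n (fun h => X h s))⁻¹ a b) P :=
  (measurable_matrix_inv_apply a b).comp_aemeasurable
    (aemeasurable_pi_lambda _ fun a => aemeasurable_pi_lambda _ fun b =>
      aemeasurable_empMatrix_apply hX hw n a b)

theorem aemeasurable_matrix_mul_apply {A B : S → Matrix (Fin m) (Fin m) ℝ}
    (hA : ∀ a b, AEMeasurable (fun s => A s a b) P) (hB : ∀ a b, AEMeasurable (fun s => B s a b) P)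
    (a b : Fin m) : AEMeasurable (fun s => (A s * B s) a b) P := by
  simp only [Matrix.mul_apply]
  exact Finset.aemeasurable_fun_sum _ fun c _ => (hA a c).mul (hB c b)

theorem tendsto_empMatrix (hX : ∀ h, HasLaw (X h) ν P) (hind : iIndepFun X P)
    {w : Fin m → Fin m → M → ℝ} (hw : ∀ a b, Measurable (w a b))
    (hwi : ∀ a b, Integrable (w a b) ν) :
    ∀ᵐ s ∂P, Tendsto (fun n => empMatrix w n fun h => X h s) atTop
      (𝓝 (Matrix.of fun a b => ∫ y, w a b y ∂ν)) := by
  have h : ∀ᵐ s ∂P, ∀ a b, Tendsto (fun n : ℕ => (n : ℝ)⁻¹ * ∑ h ∈ Finset.range n, w a b (X h s))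
      atTop (𝓝 (∫ y, w a b y ∂ν)) :=
    ae_all_iff.2 fun a => ae_all_iff.2 fun b => tendsto_sampleMean hX hind (hw a b) (hwi a b)
  filter_upwards [h] with s hs
  exact tendsto_pi_nhds.2 fun a => tendsto_pi_nhds.2 fun b => hs a b

theorem tendsto_empVector (hX : ∀ h, HasLaw (X h) ν P) (hind : iIndepFun X P)
    {d : Fin m → M → ℝ} (hd : ∀ a, Measurable (d a)) (hdi : ∀ a, Integrable (d a) ν) :
    ∀ᵐ s ∂P, Tendsto (fun n => empVector d n fun h => X h s) atTop
      (𝓝 fun a => ∫ y, d a y ∂ν) := by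
  have h : ∀ᵐ s ∂P, ∀ a, Tendsto (fun n : ℕ => (n : ℝ)⁻¹ * ∑ h ∈ Finset.range n, d a (X h s))
      atTop (𝓝 (∫ y, d a y ∂ν)) :=
    ae_all_iff.2 fun a => tendsto_sampleMean hX hind (hd a) (hdi a)
  filter_upwards [h] with s hs
  exact tendsto_pi_nhds.2 hs

/-- A positive semidefinite matrix is positive definite as soon as its determinant is nonzero, and
the determinant is continuous. -/
theorem eventually_posDef_of_tendsto {A : ℕ → Matrix (Fin m) (Fin m) ℝ}
    {W : Matrix (Fin m) (Fin m) ℝ} (hA : Tendsto A atTop (𝓝 W)) (hp : ∀ n, (A n).PosSemidef)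
    (hW : W.PosDef) : ∀ᶠ n in atTop, (A n).PosDef := by
  have hdet : Tendsto (fun n => (A n).det) atTop (𝓝 W.det) :=
    ((Continuous.matrix_det continuous_id).tendsto W).comp hA
  filter_upwards [hdet.eventually_ne hW.det_pos.ne'] with n hn
  exact (hp n).posDef_iff_det_ne_zero.2 hn

theorem tendsto_matrix_inv {A : ℕ → Matrix (Fin m) (Fin m) ℝ}
    {W : Matrix (Fin m) (Fin m) ℝ} (hA : Tendsto A atTop (𝓝 W)) (hW : W.det ≠ 0) :
    Tendsto (fun n => (A n)⁻¹) atTop (𝓝 W⁻¹) := by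
  have h : ContinuousAt Ring.inverse W.det := by
    rw [Ring.inverse_eq_inv']
    exact continuousAt_inv₀ hW
  exact (continuousAt_matrix_inv W h).tendsto.comp hA

theorem tendsto_mulVec {A : ℕ → Matrix (Fin m) (Fin m) ℝ} {W : Matrix (Fin m) (Fin m) ℝ}
    {v : ℕ → Fin m → ℝ} {u : Fin m → ℝ} (hA : Tendsto A atTop (𝓝 W)) (hv : Tendsto v atTop (𝓝 u)) :
    Tendsto (fun n => A n *ᵥ v n) atTop (𝓝 (W *ᵥ u)) := by
  refine tendsto_pi_nhds.2 fun a => ?_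
  simp only [Matrix.mulVec, dotProduct]
  exact tendsto_finsetSum _ fun b _ =>
    (tendsto_pi_nhds.1 (tendsto_pi_nhds.1 hA a) b).mul (tendsto_pi_nhds.1 hv b)

variable [IsProbabilityMeasure P]

/-- Strong consistency and asymptotic normality of the solution of a linear estimating equation,
with influence function `ψ = W⁻¹ (d - w π₀)`. -/
theorem asymptotics_empSolution (hX : ∀ h, HasLaw (X h) ν P) (hind : iIndepFun X P)
    {w : Fin m → Fin m → M → ℝ} {d ψ : Fin m → M → ℝ} {π₀ : EuclideanSpace ℝ (Fin m)}
    (hw : ∀ a b, Measurable (w a b)) (hwi : ∀ a b, Integrable (w a b) ν)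
    (hwp : ∀ y, (Matrix.of fun a b => w a b y).PosSemidef)
    (hW : (Matrix.of fun a b => ∫ y, w a b y ∂ν : Matrix (Fin m) (Fin m) ℝ).PosDef)
    (hψ : ∀ a, Measurable (ψ a)) (hL2 : ∀ a, MemLp (ψ a) 2 ν) (h0 : ∀ a, ∫ y, ψ a y ∂ν = 0)
    (hd : ∀ a y, d a y = ∑ b, w a b y * π₀ b + ∑ b, (∫ z, w a b z ∂ν) * ψ b y) :
    (∀ᵐ s ∂P, ∀ᶠ n in atTop, (empMatrix w n fun h => X h s).PosDef) ∧
    (∀ᵐ s ∂P, Tendsto (fun n => empSolution w d n fun h => X h s) atTop (𝓝 π₀)) ∧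
    TendstoInDistribution
      (fun (n : ℕ) s => √(n : ℝ) • (empSolution w d n (fun h => X h s) - π₀))
      atTop (id : EuclideanSpace ℝ (Fin m) → EuclideanSpace ℝ (Fin m))
      (fun _ => P) (multivariateGaussian 0 (secondMoment ν ψ)) := by
  have hνP : IsProbabilityMeasure ν := (hX 0).isProbabilityMeasure_iff.1 inferInstance
  set W : Matrix (Fin m) (Fin m) ℝ := Matrix.of fun a b => ∫ y, w a b y ∂ν with hWdef
  have hWdet : W.det ≠ 0 := hW.det_pos.ne'
  have hd' : ∀ a y, d a y = ∑ b, w a b y * π₀ b + ∑ b, W a b * ψ b y := hd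
  have hWn := tendsto_empMatrix hX hind hw hwi
  have hpos : ∀ᵐ s ∂P, ∀ᶠ n in atTop, (empMatrix w n fun h => X h s).PosDef := by
    filter_upwards [hWn] with s hs
    exact eventually_posDef_of_tendsto hs (fun n => posSemidef_empMatrix hwp n _) hW
  have hinv : ∀ᵐ s ∂P, Tendsto (fun n => (empMatrix w n fun h => X h s)⁻¹) atTop (𝓝 W⁻¹) := by
    filter_upwards [hWn] with s hs
    exact tendsto_matrix_inv hs hWdet
  refine ⟨hpos, ?_, ?_⟩
  · have hψn := tendsto_empVector hX hind hψ fun a => (hL2 a).integrable (by norm_num)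
    simp only [h0] at hψn
    filter_upwards [hWn, hinv, hψn] with s hs hi hp
    have hv : Tendsto (fun n => empVector d n fun h => X h s) atTop (𝓝 (W *ᵥ π₀)) := by
      simp only [empVector_eq hd']
      have h1 := (tendsto_mulVec hs (tendsto_const_nhds (x := (π₀ : Fin m → ℝ)))).add
        (tendsto_mulVec (tendsto_const_nhds (x := W)) hp)
      rwa [show (fun _ : Fin m => (0 : ℝ)) = 0 from rfl, Matrix.mulVec_zero, add_zero] at h1
    have h3 := tendsto_mulVec hi hv
    rw [Matrix.mulVec_mulVec, Matrix.nonsing_inv_mul _ (isUnit_iff_ne_zero.2 hWdet),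
      Matrix.one_mulVec] at h3
    exact ((PiLp.continuous_toLp 2 fun _ : Fin m => ℝ).tendsto _).comp h3
  · have hXm : ∀ h, AEMeasurable (X h) P := fun h => (hX h).aemeasurable
    -- the coefficient matrix `W_n⁻¹ W` and the remainder of the error decomposition
    set B : ℕ → S → (Fin m → Fin m → ℝ) := fun n s a b =>
      ((empMatrix w n fun h => X h s)⁻¹ * W) a b with hB
    set R : ℕ → S → (Fin m → ℝ) := fun n s =>
      √(n : ℝ) • (((empMatrix w n fun h => X h s)⁻¹ * (empMatrix w n fun h => X h s) - 1) *ᵥ π₀)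
      with hR
    have hBm : ∀ n, AEMeasurable (B n) P := fun n =>
      aemeasurable_pi_lambda _ fun a => aemeasurable_pi_lambda _ fun b =>
        aemeasurable_matrix_mul_apply (A := fun s => (empMatrix w n fun h => X h s)⁻¹)
          (B := fun _ => W) (fun a b => aemeasurable_empMatrix_inv_apply hXm hw n a b)
          (fun _ _ => aemeasurable_const) a b
    have hprod : ∀ n a b, AEMeasurable (fun s => ((empMatrix w n fun h => X h s)⁻¹ *
        empMatrix w n fun h => X h s) a b) P := fun n a b =>
      aemeasurable_matrix_mul_apply (A := fun s => (empMatrix w n fun h => X h s)⁻¹)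
        (B := fun s => empMatrix w n fun h => X h s)
        (fun a b => aemeasurable_empMatrix_inv_apply hXm hw n a b)
        (fun a b => aemeasurable_empMatrix_apply hXm hw n a b) a b
    have hRm : ∀ n, AEMeasurable (R n) P := fun n => aemeasurable_pi_lambda _ fun a => by
      simp only [hR, Pi.smul_apply, smul_eq_mul, Matrix.mulVec, dotProduct, Matrix.sub_apply]
      exact (Finset.aemeasurable_fun_sum _ fun b _ =>
        ((hprod n a b).sub_const _).mul_const _).const_mul _
    have hBt : ∀ᵐ s ∂P, Tendsto (fun n => B n s) atTop (𝓝 (1 : Matrix (Fin m) (Fin m) ℝ)) := by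
      filter_upwards [hinv] with s hs
      have h1 := ((continuous_id.matrix_mul (continuous_const (y := W))).tendsto W⁻¹).comp hs
      rw [id, Matrix.nonsing_inv_mul _ (isUnit_iff_ne_zero.2 hWdet)] at h1
      exact h1
    have hRt : ∀ᵐ s ∂P, Tendsto (fun n => R n s) atTop (𝓝 0) := by
      filter_upwards [hpos] with s hs
      refine tendsto_const_nhds.congr' ?_
      filter_upwards [hs] with n hn
      simp only [hR]
      rw [Matrix.nonsing_inv_mul _ (isUnit_iff_ne_zero.2 hn.det_pos.ne'), sub_self,
        Matrix.zero_mulVec, smul_zero]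
    have hBR : TendstoInMeasure P (fun n s => (B n s, R n s)) atTop
        fun _ => ((1 : Matrix (Fin m) (Fin m) ℝ), (0 : Fin m → ℝ)) :=
      tendstoInMeasure_of_tendsto_ae (E := (Fin m → Fin m → ℝ) × (Fin m → ℝ))
        (fun n => ((hBm n).prodMk (hRm n)).aestronglyMeasurable) (by
        filter_upwards [hBt, hRt] with s h1 h2
        exact h1.prodMk_nhds h2)
    set G : EuclideanSpace ℝ (Fin m) × ((Fin m → Fin m → ℝ) × (Fin m → ℝ)) →
        EuclideanSpace ℝ (Fin m) := fun q =>
      WithLp.toLp 2 (Matrix.of q.2.1 *ᵥ q.1) + WithLp.toLp 2 q.2.2 with hG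
    have hGc : Continuous G := by
      refine Continuous.add ((PiLp.continuous_toLp 2 _).comp ?_)
        ((PiLp.continuous_toLp 2 _).comp (by fun_prop))
      refine Continuous.matrix_mulVec ?_ ((PiLp.continuous_ofLp 2 _).comp continuous_fst)
      exact continuous_fst.comp continuous_snd
    have hfin := (tendstoInDistribution_sum_vector hX hind hψ hL2 h0).continuous_comp_prodMk_of_tendstoInMeasure_const
      hGc hBR fun n => (hBm n).prodMk (hRm n)
    refine hfin.congr (fun n => ae_of_all _ fun s => ?_) (ae_of_all _ fun z => ?_)
    · exact (sqrt_smul_empSolution_sub hd' n fun h => X h s).symm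
    · simp only [hG, id, WithLp.toLp_zero, add_zero]
      exact congrArg (WithLp.toLp 2) (Matrix.one_mulVec (z : Fin m → ℝ))

end LinearEstimatingEquation

/-! ### The Cramér-Rao inequality and the exponential family -/

section CramerRao

variable {M : Type u} [MeasurableSpace M] {m : ℕ} {ν : Measure M}

/-- The Cramér-Rao inequality for influence functions: if `E[ψ_a T_b]` is the identity matrix, then
`E[ψ ψᵀ] - E[T Tᵀ]⁻¹` is the matrix of second moments of `ψ - E[T Tᵀ]⁻¹ T`. -/
theorem posSemidef_secondMoment_sub_inv {ψ T : Fin m → M → ℝ} (hψ : ∀ a, MemLp (ψ a) 2 ν)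
    (hT : ∀ a, MemLp (T a) 2 ν) (hI : (secondMoment ν T).PosDef)
    (hc : ∀ a b, ∫ y, ψ a y * T b y ∂ν = (1 : Matrix (Fin m) (Fin m) ℝ) a b) :
    (secondMoment ν ψ - (secondMoment ν T)⁻¹).PosSemidef := by
  have h1 : ∀ a b, Integrable (fun y => ψ a y * ψ b y) ν := fun a b => (hψ a).integrable_mul (hψ b)
  have h2 : ∀ a b, Integrable (fun y => T a y * T b y) ν := fun a b => (hT a).integrable_mul (hT b)
  have h3 : ∀ a b, Integrable (fun y => ψ a y * T b y) ν := fun a b => (hψ a).integrable_mul (hT b)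
  refine Matrix.PosSemidef.of_dotProduct_mulVec_nonneg
    ((isHermitian_secondMoment ν ψ).sub hI.isHermitian.inv) fun r => ?_
  set q := (secondMoment ν T)⁻¹ *ᵥ r with hq
  have hIq : secondMoment ν T *ᵥ q = r := by
    rw [hq, Matrix.mulVec_mulVec, Matrix.mul_nonsing_inv _ (isUnit_iff_ne_zero.2 hI.det_pos.ne'),
      Matrix.one_mulVec]
  have e1 := dotProduct_secondMoment h1 r
  have e2 := dotProduct_secondMoment h2 q
  have e3 : ∫ y, (∑ a, r a * ψ a y) * ∑ b, q b * T b y ∂ν = r ⬝ᵥ q := by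
    rw [integral_sum_mul_sum h3]
    simp only [hc, Matrix.one_apply, mul_ite, mul_one, mul_zero, Finset.sum_ite_eq,
      Finset.mem_univ, if_true, dotProduct]
  rw [hIq, dotProduct_comm] at e2
  have hsq : ∫ y, ((∑ a, r a * ψ a y) - ∑ b, q b * T b y) ^ 2 ∂ν =
      r ⬝ᵥ secondMoment ν ψ *ᵥ r - r ⬝ᵥ q := by
    have i1 := integrable_sum_mul_sum h1 r r
    have i2 := integrable_sum_mul_sum h2 q q
    have i3 := integrable_sum_mul_sum h3 r q
    have i4 : Integrable (fun y => (∑ a, r a * ψ a y) * (∑ a, r a * ψ a y) -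
        2 * ((∑ a, r a * ψ a y) * ∑ b, q b * T b y)) ν := i1.sub (i3.const_mul 2)
    simp only [pow_two] at e1 e2
    calc ∫ y, ((∑ a, r a * ψ a y) - ∑ b, q b * T b y) ^ 2 ∂ν
        = ∫ y, (((∑ a, r a * ψ a y) * ∑ a, r a * ψ a y) -
            2 * ((∑ a, r a * ψ a y) * ∑ b, q b * T b y)) +
            (∑ b, q b * T b y) * ∑ b, q b * T b y ∂ν := by
          refine integral_congr_ae (ae_of_all _ fun y => ?_)
          simp only
          ring
      _ = r ⬝ᵥ secondMoment ν ψ *ᵥ r - r ⬝ᵥ q := by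
          rw [integral_add i4 i2, integral_sub i1 (i3.const_mul 2),
            integral_const_mul, ← e1, ← e2, e3]
          ring
  rw [star_trivial, Matrix.sub_mulVec, dotProduct_sub, ← hq, ← hsq]
  exact integral_nonneg fun y => sq_nonneg _

end CramerRao

section ExponentialFamily

variable {M : Type u} {m : ℕ} {t : Fin m → M → ℝ}

theorem eq_zero_of_sum_eq_const
    (hA : LinearIndependent ℝ (Fin.cons (fun _ => 1) t : Fin (m + 1) → M → ℝ)) {r : Fin m → ℝ}
    {c : ℝ} (h : ∀ y, ∑ a, r a * t a y = c) : r = 0 := by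
  have := Fintype.linearIndependent_iff.1 hA (Fin.cons (-c) r) (by
    ext y
    simp [Fin.sum_univ_succ, Finset.sum_apply, h y])
  ext a
  simpa using this a.succ

/-- The linear form `π ↦ πᵀ t(y)`. -/
def statForm (t : Fin m → M → ℝ) (y : M) : EuclideanSpace ℝ (Fin m) →L[ℝ] ℝ :=
  ∑ l, t l y • EuclideanSpace.proj l

theorem statForm_apply (t : Fin m → M → ℝ) (y : M) (π : EuclideanSpace ℝ (Fin m)) :
    statForm t y π = ∑ l, π l * t l y := by
  simp [statForm, sum_apply, mul_comm]

/-- The normalizing constant of the exponential family. -/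
def partition [MeasurableSpace M] (μ : Measure M) (t : Fin m → M → ℝ)
    (π : EuclideanSpace ℝ (Fin m)) : ℝ :=
  ∫ y, Real.exp (∑ l, π l * t l y) ∂μ

theorem density_eq [MeasurableSpace M] (μ : Measure M) (t : Fin m → M → ℝ)
    (π : EuclideanSpace ℝ (Fin m)) (x : M) :
    density μ t π x = (partition μ t π)⁻¹ * Real.exp (∑ l, π l * t l x) := by
  rw [density, div_eq_inv_mul, partition]

/-- The statistic `t`, centred at its mean. -/
def centredStat [MeasurableSpace M] (μ : Measure M) (t : Fin m → M → ℝ)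
    (π : EuclideanSpace ℝ (Fin m)) (a : Fin m)
    (y : M) : ℝ :=
  t a y - ∫ z, t a z ∂(expFamily μ t π)

variable [TopologicalSpace M]

theorem continuous_statForm (ht : ∀ l, Continuous (t l)) : Continuous (statForm t) :=
  continuous_finsetSum _ fun l _ => (ht l).smul continuous_const

theorem continuous_exp_stat (ht : ∀ l, Continuous (t l)) (π : EuclideanSpace ℝ (Fin m)) :
    Continuous fun y => Real.exp (∑ l, π l * t l y) := by
  fun_prop

theorem continuous_density [MeasurableSpace M] {μ : Measure M} (ht : ∀ l, Continuous (t l))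
    (π : EuclideanSpace ℝ (Fin m)) :
    Continuous (density μ t π) :=
  (continuous_exp_stat ht π).div_const _

theorem continuous_centredStat [MeasurableSpace M] {μ : Measure M} (ht : ∀ l, Continuous (t l))
    (π : EuclideanSpace ℝ (Fin m))
    (a : Fin m) : Continuous (centredStat μ t π a) :=
  (ht a).sub continuous_const

variable [MeasurableSpace M] [CompactSpace M] [BorelSpace M]

theorem integrable_of_continuous {ν : Measure M} [IsFiniteMeasure ν] {f : M → ℝ}
    (hf : Continuous f) : Integrable f ν :=
  hf.integrable_of_hasCompactSupport (HasCompactSupport.of_compactSpace _)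

theorem memLp_two_of_continuous {ν : Measure M} [IsFiniteMeasure ν] {f : M → ℝ}
    (hf : Continuous f) : MemLp f 2 ν :=
  hf.memLp_of_hasCompactSupport (HasCompactSupport.of_compactSpace _)

variable {μ : Measure M} [IsFiniteMeasure μ]

/-- Differentiation under the integral sign; the derivatives are bounded by compactness of the unit
ball times `M`. -/
theorem hasFDerivAt_partition (ht : ∀ l, Continuous (t l)) (π : EuclideanSpace ℝ (Fin m)) :
    HasFDerivAt (partition μ t) (∫ y, Real.exp (∑ l, π l * t l y) • statForm t y ∂μ) π := by
  have hc := continuous_statForm ht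
  have hF : Continuous fun q : EuclideanSpace ℝ (Fin m) × M =>
      Real.exp (statForm t q.2 q.1) • statForm t q.2 :=
    (Real.continuous_exp.comp ((hc.comp continuous_snd).clm_apply continuous_fst)).smul
      (hc.comp continuous_snd)
  obtain ⟨C, hC⟩ := ((isCompact_closedBall π 1).prod isCompact_univ).exists_bound_of_continuousOn
    (hF.continuousOn (s := Metric.closedBall π 1 ×ˢ (Set.univ : Set M)))
  have key := hasFDerivAt_integral_of_dominated_of_fderiv_le (μ := μ) (𝕜 := ℝ)
    (F := fun (θ : EuclideanSpace ℝ (Fin m)) y => Real.exp (statForm t y θ))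
    (F' := fun θ y => Real.exp (statForm t y θ) • statForm t y) (x₀ := π)
    (s := Metric.ball π 1) (bound := fun _ => C) (Metric.ball_mem_nhds π one_pos)
    (Eventually.of_forall fun θ =>
      (Real.continuous_exp.comp (hc.clm_apply continuous_const)).aestronglyMeasurable)
    (integrable_of_continuous (Real.continuous_exp.comp (hc.clm_apply continuous_const)))
    (hF.comp (Continuous.prodMk_right π)).aestronglyMeasurable
    (ae_of_all _ fun y θ hθ => hC (θ, y) ⟨Metric.ball_subset_closedBall hθ, Set.mem_univ y⟩)
    (integrable_const C)
    (ae_of_all _ fun y θ _ => (statForm t y).hasFDerivAt.exp)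
  have hp : partition μ t = fun θ => ∫ y, Real.exp (statForm t y θ) ∂μ := by
    ext θ
    simp only [partition, statForm_apply]
  rw [hp]
  simp only [← statForm_apply]
  exact key

variable [Nonempty M] [μ.IsOpenPosMeasure]

theorem partition_pos (ht : ∀ l, Continuous (t l)) (π : EuclideanSpace ℝ (Fin m)) :
    0 < partition μ t π := by
  obtain ⟨y⟩ := ‹Nonempty M›
  exact (continuous_exp_stat ht π).integral_pos_of_hasCompactSupport_nonneg_nonzero
    (HasCompactSupport.of_compactSpace _) (fun z => (Real.exp_pos _).le) (Real.exp_pos _).ne' (x := y)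

theorem density_pos (ht : ∀ l, Continuous (t l)) (π : EuclideanSpace ℝ (Fin m)) (x : M) :
    0 < density μ t π x :=
  div_pos (Real.exp_pos _) (partition_pos ht π)

theorem integral_expFamily (ht : ∀ l, Continuous (t l)) (π : EuclideanSpace ℝ (Fin m))
    (f : M → ℝ) : ∫ y, f y ∂(expFamily μ t π) = ∫ y, density μ t π y * f y ∂μ := by
  rw [expFamily, integral_withDensity_eq_integral_toReal_smul
    (continuous_density ht π).measurable.ennreal_ofReal (ae_of_all _ fun _ => ENNReal.ofReal_lt_top)]
  refine integral_congr_ae (ae_of_all _ fun y => ?_)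
  simp only [smul_eq_mul]
  rw [ENNReal.toReal_ofReal (density_pos ht π y).le]

theorem isProbabilityMeasure_expFamily (ht : ∀ l, Continuous (t l))
    (π : EuclideanSpace ℝ (Fin m)) : IsProbabilityMeasure (expFamily μ t π) := by
  refine ⟨?_⟩
  rw [expFamily, withDensity_apply _ MeasurableSet.univ, Measure.restrict_univ,
    ← ofReal_integral_eq_lintegral_ofReal (integrable_of_continuous (continuous_density ht π))
      (ae_of_all _ fun y => (density_pos ht π y).le)]
  simp only [density_eq]
  rw [integral_const_mul]
  change ENNReal.ofReal ((partition μ t π)⁻¹ * partition μ t π) = 1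
  rw [inv_mul_cancel₀ (partition_pos ht π).ne', ENNReal.ofReal_one]

theorem integral_expFamily_pos (ht : ∀ l, Continuous (t l)) (π : EuclideanSpace ℝ (Fin m))
    {f : M → ℝ} (hf : Continuous f) (h0 : ∀ y, 0 ≤ f y) {y : M} (hy : f y ≠ 0) :
    0 < ∫ y, f y ∂(expFamily μ t π) := by
  rw [integral_expFamily ht]
  exact ((continuous_density ht π).mul hf).integral_pos_of_hasCompactSupport_nonneg_nonzero
    (HasCompactSupport.of_compactSpace _) (fun z => mul_nonneg (density_pos ht π z).le (h0 z))
    (mul_ne_zero (density_pos ht π y).ne' hy) (x := y)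

/-- The score of a canonical exponential family is the centred statistic. -/
theorem partialDeriv_log_density (ht : ∀ l, Continuous (t l)) (π : EuclideanSpace ℝ (Fin m))
    (a : Fin m) (y : M) :
    partialDeriv a (fun θ => Real.log (density μ t θ y)) π = centredStat μ t π a y := by
  have hlog : (fun θ => Real.log (density μ t θ y)) =
      fun θ => statForm t y θ - Real.log (partition μ t θ) := by
    ext θ
    change Real.log (_ / partition μ t θ) = _
    rw [Real.log_div (Real.exp_pos _).ne' (partition_pos ht θ).ne', Real.log_exp, statForm_apply]
  have hd := (statForm t y).hasFDerivAt.sub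
    ((hasFDerivAt_partition (μ := μ) ht π).log (partition_pos ht π).ne')
  have hsingle : ∀ z, statForm t z (EuclideanSpace.single a 1) = t a z := fun z => by
    simp [statForm_apply]
  have hint : Integrable (fun z => Real.exp (∑ l, π l * t l z) • statForm t z) μ :=
    ((continuous_exp_stat ht π).smul (continuous_statForm ht)).integrable_of_hasCompactSupport
      (HasCompactSupport.of_compactSpace _)
  rw [partialDeriv, hlog]
  erw [hd.fderiv]
  rw [sub_apply, smul_apply, hsingle, ContinuousLinearMap.integral_apply hint, centredStat,
    integral_expFamily ht]
  simp only [smul_apply, hsingle, smul_eq_mul, density_eq, mul_assoc]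
  rw [integral_const_mul]

theorem fisherInformation_eq (ht : ∀ l, Continuous (t l)) (π : EuclideanSpace ℝ (Fin m)) :
    fisherInformation μ t π = secondMoment (expFamily μ t π) (centredStat μ t π) := by
  ext a b
  simp only [fisherInformation, secondMoment, Matrix.of_apply, partialDeriv_log_density ht]

/-- If `rᵀ I r = 0`, then `rᵀ t` equals its mean everywhere, against the linear independence of
`1, t`. -/
theorem posDef_fisherInformation (ht : ∀ l, Continuous (t l))
    (hA : LinearIndependent ℝ (Fin.cons (fun _ => 1) t : Fin (m + 1) → M → ℝ))
    (π : EuclideanSpace ℝ (Fin m)) : (fisherInformation μ t π).PosDef := by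
  have := isProbabilityMeasure_expFamily (μ := μ) ht π
  rw [fisherInformation_eq ht]
  have hcT := continuous_centredStat (μ := μ) ht π
  refine Matrix.PosDef.of_dotProduct_mulVec_pos (isHermitian_secondMoment _ _) fun r hr => ?_
  rw [star_trivial, dotProduct_secondMoment fun a b =>
    integrable_of_continuous ((hcT a).mul (hcT b))]
  by_contra hneg
  refine hr (eq_zero_of_sum_eq_const hA
    (c := ∑ a, r a * ∫ z, t a z ∂(expFamily μ t π)) fun y => ?_)
  by_contra hne
  refine hneg (integral_expFamily_pos ht π (by fun_prop) (fun y => sq_nonneg _) (y := y) ?_)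
  refine pow_ne_zero 2 fun h0 => hne ?_
  simpa only [centredStat, mul_sub, Finset.sum_sub_distrib, sub_eq_zero] using h0

end ExponentialFamily

/-! ### The score matching identity -/

section ScoreIdentity

variable {p m : ℕ} {M : Type u} [TopologicalSpace M] [ChartedSpace (Coord p) M]

theorem contMDiff_stat {t : Fin m → M → ℝ} (ht : ∀ l, ContMDiff (𝓡 p) 𝓘(ℝ, ℝ) 1 (t l))
    (π : Fin m → ℝ) : ContMDiff (𝓡 p) 𝓘(ℝ, ℝ) 1 fun y => ∑ l, π l * t l y :=
  contMDiff_finsetSum fun l _ => contMDiff_const.mul (ht l)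

theorem contMDiff_density [MeasurableSpace M] {t : Fin m → M → ℝ}
    (ht : ∀ l, ContMDiff (𝓡 p) 𝓘(ℝ, ℝ) 1 (t l))
    (μ : Measure M) (π : EuclideanSpace ℝ (Fin m)) :
    ContMDiff (𝓡 p) 𝓘(ℝ, ℝ) 1 (density μ t π) := by
  have h : density μ t π = fun y => (partition μ t π)⁻¹ * Real.exp (∑ l, π l * t l y) :=
    funext (density_eq μ t π)
  rw [h]
  exact contMDiff_const.mul (Real.contDiff_exp.contMDiff.comp (contMDiff_stat ht π))

variable [IsManifold (𝓡 p) ∞ M]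

/-- The estimating function of score matching,
`-Δ t_a - ∑ b, ⟨t_a, t_b⟩ π_b`, which has mean zero under the parameter `π`. -/
def scoreResidual (g : RiemannianMetric p M) (t : Fin m → M → ℝ) (π : EuclideanSpace ℝ (Fin m))
    (a : Fin m) (y : M) : ℝ :=
  -laplaceBeltrami g (t a) y - ∑ b, gradInner g (t a) (t b) y * π b

theorem sum_mul_gradInner (g : RiemannianMetric p M) {t : Fin m → M → ℝ}
    (ht : ∀ l, ContMDiff (𝓡 p) 𝓘(ℝ, ℝ) 1 (t l)) (r : Fin m → ℝ) (y : M) :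
    r ⬝ᵥ (Matrix.of fun a b => gradInner g (t a) (t b) y) *ᵥ r =
      gradInner g (fun z => ∑ l, r l * t l z) (fun z => ∑ l, r l * t l z) y := by
  rw [gradInner_sum_left g _ fun l _ => ht l]
  simp only [dotProduct, Matrix.mulVec, Matrix.of_apply]
  refine Finset.sum_congr rfl fun a _ => ?_
  rw [gradInner_comm, gradInner_sum_left g _ fun l _ => ht l]
  congr 1
  refine Finset.sum_congr rfl fun b _ => ?_
  rw [gradInner_comm, mul_comm]

theorem posSemidef_gradInner (g : RiemannianMetric p M) {t : Fin m → M → ℝ}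
    (ht : ∀ l, ContMDiff (𝓡 p) 𝓘(ℝ, ℝ) 1 (t l)) (y : M) :
    (Matrix.of fun a b => gradInner g (t a) (t b) y : Matrix (Fin m) (Fin m) ℝ).PosSemidef := by
  refine Matrix.PosSemidef.of_dotProduct_mulVec_nonneg ?_ fun r => ?_
  · ext a b
    simp [gradInner_comm g (t a) (t b)]
  · rw [star_trivial, sum_mul_gradInner g ht]
    exact gradInner_self_nonneg g _ y

variable [MeasurableSpace M]

theorem gradInner_density_left (g : RiemannianMetric p M) {t : Fin m → M → ℝ}
    (ht : ∀ l, ContMDiff (𝓡 p) 𝓘(ℝ, ℝ) 1 (t l)) (μ : Measure M) (π : EuclideanSpace ℝ (Fin m))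
    (w : M → ℝ) (y : M) :
    gradInner g (density μ t π) w y = density μ t π y * ∑ b, π b * gradInner g (t b) w y := by
  have h : density μ t π = fun y => (partition μ t π)⁻¹ * Real.exp (∑ l, π l * t l y) :=
    funext (density_eq μ t π)
  have hs := contMDiff_stat ht π
  have he : ContMDiff (𝓡 p) 𝓘(ℝ, ℝ) 1 fun y => Real.exp (∑ l, π l * t l y) :=
    Real.contDiff_exp.contMDiff.comp hs
  rw [h, gradInner_mul_left g contMDiff_const he, gradInner_const_left, mul_zero, add_zero,
    gradInner_exp_left g hs, gradInner_sum_left g _ fun l _ => ht l, mul_assoc]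

variable [BorelSpace M] [CompactSpace M]

/-- A linear combination of the statistics with vanishing gradient is constant, hence trivial. -/
theorem posDef_integral_gradInner [ConnectedSpace M] (g : RiemannianMetric p M)
    {t : Fin m → M → ℝ}
    (hA : LinearIndependent ℝ (Fin.cons (fun _ => 1) t : Fin (m + 1) → M → ℝ))
    (ht : ∀ l, ContMDiff (𝓡 p) 𝓘(ℝ, ℝ) 1 (t l)) (π : EuclideanSpace ℝ (Fin m)) :
    (Matrix.of fun a b => ∫ y, gradInner g (t a) (t b) y ∂(expFamily (uniformMeasure g) t π) :
      Matrix (Fin m) (Fin m) ℝ).PosDef := by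
  have := isFiniteMeasure_uniformMeasure g
  have := isOpenPosMeasure_uniformMeasure g
  have htc : ∀ l, Continuous (t l) := fun l => (ht l).continuous
  have := isProbabilityMeasure_expFamily (μ := uniformMeasure g) htc π
  have hint : ∀ a b, Integrable (fun y => gradInner g (t a) (t b) y)
      (expFamily (uniformMeasure g) t π) := fun a b =>
    integrable_of_continuous (continuous_gradInner g (ht a) (ht b))
  refine Matrix.PosDef.of_dotProduct_mulVec_pos ?_ fun r hr => ?_
  · ext a b
    simp [gradInner_comm g (t a) (t b)]
  set u : M → ℝ := fun z => ∑ l, r l * t l z with hu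
  have hu1 : ContMDiff (𝓡 p) 𝓘(ℝ, ℝ) 1 u := contMDiff_stat ht r
  have heq : star r ⬝ᵥ (Matrix.of fun a b => ∫ y, gradInner g (t a) (t b) y
      ∂(expFamily (uniformMeasure g) t π)) *ᵥ r =
      ∫ y, gradInner g u u y ∂(expFamily (uniformMeasure g) t π) := by
    rw [star_trivial]
    simp only [hu, ← sum_mul_gradInner g ht]
    simp only [dotProduct, Matrix.mulVec, Matrix.of_apply, Finset.mul_sum]
    rw [integral_finsetSum _ fun a _ => integrable_finsetSum _ fun b _ =>
      ((hint a b).mul_const _).const_mul _]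
    refine Finset.sum_congr rfl fun a _ => ?_
    rw [integral_finsetSum _ fun b _ => ((hint a b).mul_const _).const_mul _]
    refine Finset.sum_congr rfl fun b _ => ?_
    rw [integral_const_mul, integral_mul_const]
  rw [heq]
  by_contra hneg
  have h0 : ∀ y, gradInner g u u y = 0 := fun y => by
    by_contra hne
    exact hneg (integral_expFamily_pos htc π (continuous_gradInner g hu1 hu1)
      (gradInner_self_nonneg g u) hne)
  obtain ⟨y₀⟩ : Nonempty M := inferInstance
  exact hr (eq_zero_of_sum_eq_const hA (c := u y₀) fun y =>
    eq_of_gradInner_self_eq_zero g hu1 h0 y y₀)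

variable [T2Space M]

/-- The score matching identity: Green's formula, applied to `v` times the density, evaluates the
covariances of the estimating function. -/
theorem integral_mul_scoreResidual [Nonempty M] (g : RiemannianMetric p M) {t : Fin m → M → ℝ}
    (ht : ∀ l, ContMDiff (𝓡 p) 𝓘(ℝ, ℝ) 2 (t l)) (π : EuclideanSpace ℝ (Fin m)) {v : M → ℝ}
    (hv : ContMDiff (𝓡 p) 𝓘(ℝ, ℝ) 1 v) (a : Fin m) :
    ∫ y, v y * scoreResidual g t π a y ∂(expFamily (uniformMeasure g) t π) =
      ∫ y, gradInner g v (t a) y ∂(expFamily (uniformMeasure g) t π) := by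
  have := isFiniteMeasure_uniformMeasure g
  have := isOpenPosMeasure_uniformMeasure g
  have ht1 : ∀ l, ContMDiff (𝓡 p) 𝓘(ℝ, ℝ) 1 (t l) := fun l => (ht l).of_le (by norm_num)
  have htc : ∀ l, Continuous (t l) := fun l => (ht l).continuous
  set μ := uniformMeasure g
  have hρ := contMDiff_density ht1 μ π
  have hgreen := integral_mul_laplaceBeltrami g (hv.mul hρ) (ht a)
  have hL := continuous_laplaceBeltrami g (ht a)
  have hg : ∀ b, Continuous (gradInner g (t b) (t a)) := fun b =>
    continuous_gradInner g (ht1 b) (ht1 a)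
  have hgv := continuous_gradInner g hv (ht1 a)
  have hρc := hρ.continuous
  have hvc := hv.continuous
  have hsplit : ∀ y, gradInner g (v * density μ t π) (t a) y =
      density μ t π y * gradInner g v (t a) y +
        v y * density μ t π y * ∑ b, π b * gradInner g (t b) (t a) y := fun y => by
    have := gradInner_mul_left g hv hρ (t a) y
    rw [gradInner_density_left g ht1] at this
    change gradInner g (fun z => v z * density μ t π z) (t a) y = _
    rw [this]
    ring
  simp only [hsplit] at hgreen
  have hc1 : Continuous fun y => density μ t π y * gradInner g v (t a) y := hρc.mul hgv
  have hc2 : Continuous fun y => v y * density μ t π y * ∑ b, π b * gradInner g (t b) (t a) y :=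
    (hvc.mul hρc).mul (continuous_finsetSum _ fun b _ => continuous_const.mul (hg b))
  have hc3 : Continuous fun y => (v * density μ t π) y * laplaceBeltrami g (t a) y :=
    (hvc.mul hρc).mul hL
  rw [integral_add (integrable_of_continuous hc1) (integrable_of_continuous hc2)] at hgreen
  rw [integral_expFamily htc, integral_expFamily htc]
  have hpoint : ∀ y, density μ t π y * (v y * scoreResidual g t π a y) =
      -((v * density μ t π) y * laplaceBeltrami g (t a) y) -
        v y * density μ t π y * ∑ b, π b * gradInner g (t b) (t a) y := fun y => by
    have : ∑ b, gradInner g (t a) (t b) y * π b = ∑ b, π b * gradInner g (t b) (t a) y :=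
      Finset.sum_congr rfl fun b _ => by rw [gradInner_comm, mul_comm]
    rw [scoreResidual, this, Pi.mul_apply]
    ring
  simp only [hpoint]
  have hc3' : Integrable (fun y => -((v * density μ t π) y * laplaceBeltrami g (t a) y)) μ :=
    (integrable_of_continuous hc3).neg
  rw [integral_sub hc3' (integrable_of_continuous hc2), integral_neg]
  linarith

end ScoreIdentity

end ScoreMatching

end

theorem mainTheorem3 {p m : ℕ} {M : Type u} [TopologicalSpace M]
    [ChartedSpace (ScoreMatching.Coord p) M] [IsManifold (𝓡 p) ∞ M]
    [T2Space M] [CompactSpace M] [ConnectedSpace M] [MeasurableSpace M] [BorelSpace M]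
    (g : ScoreMatching.RiemannianMetric p M)
    (t : Fin m → M → ℝ)
    (hA1 : LinearIndependent ℝ (Fin.cons (fun _ => 1) t : Fin (m + 1) → M → ℝ))
    (hA2 : ∀ l, ContMDiff (𝓡 p) 𝓘(ℝ, ℝ) 2 (t l))
    (π₀ : EuclideanSpace ℝ (Fin m)) :
    ∃ Ω : Matrix (Fin m) (Fin m) ℝ,
      Ω.PosSemidef ∧
      (ScoreMatching.fisherInformation (ScoreMatching.uniformMeasure g) t π₀).PosDef ∧
      (Ω - (ScoreMatching.fisherInformation
        (ScoreMatching.uniformMeasure g) t π₀)⁻¹).PosSemidef ∧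
      ∀ (S : Type v) [MeasurableSpace S] (P : Measure S) [IsProbabilityMeasure P]
        (X : ℕ → S → M),
        (∀ h, HasLaw (X h)
          (ScoreMatching.expFamily (ScoreMatching.uniformMeasure g) t π₀) P) →
        iIndepFun X P →
        (∀ᵐ s ∂P, ∀ᶠ n in atTop, (ScoreMatching.sampleW g t n (fun h => X h s)).PosDef) ∧
        (∀ᵐ s ∂P,
          Tendsto (fun n => ScoreMatching.sme g t n (fun h => X h s)) atTop (𝓝 π₀)) ∧
        TendstoInDistribution
          (fun (n : ℕ) s => √(n : ℝ) • (ScoreMatching.sme g t n (fun h => X h s) - π₀))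
          atTop (id : EuclideanSpace ℝ (Fin m) → EuclideanSpace ℝ (Fin m))
          (fun _ => P) (multivariateGaussian 0 Ω) := by
  open ScoreMatching in
  have := isFiniteMeasure_uniformMeasure g
  have := isOpenPosMeasure_uniformMeasure g
  have ht1 : ∀ l, ContMDiff (𝓡 p) 𝓘(ℝ, ℝ) 1 (t l) := fun l => (hA2 l).of_le (by norm_num)
  have htc : ∀ l, Continuous (t l) := fun l => (hA2 l).continuous
  set μ := uniformMeasure g with hμ
  have := isProbabilityMeasure_expFamily (μ := μ) htc π₀
  set ν := expFamily μ t π₀ with hν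
  set W : Matrix (Fin m) (Fin m) ℝ := Matrix.of fun a b => ∫ y, gradInner g (t a) (t b) y ∂ν
    with hW
  have hWp : W.PosDef := posDef_integral_gradInner g hA1 ht1 π₀
  have hWu : IsUnit W.det := isUnit_iff_ne_zero.2 hWp.det_pos.ne'
  have hwc : ∀ a b, Continuous (gradInner g (t a) (t b)) := fun a b =>
    continuous_gradInner g (ht1 a) (ht1 b)
  have hYc : ∀ a, Continuous (scoreResidual g t π₀ a) := fun a =>
    (continuous_laplaceBeltrami g (hA2 a)).neg.sub
      (continuous_finsetSum _ fun b _ => (hwc a b).mul continuous_const)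
  -- the influence function `W⁻¹ Y` of the estimator
  set ψ : Fin m → M → ℝ := fun a y => ∑ c, W⁻¹ a c * scoreResidual g t π₀ c y with hψ
  have hψc : ∀ a, Continuous (ψ a) := fun a =>
    continuous_finsetSum _ fun c _ => continuous_const.mul (hYc c)
  have hTc := continuous_centredStat (μ := μ) htc π₀
  have hY0 : ∀ a, ∫ y, scoreResidual g t π₀ a y ∂ν = 0 := fun a => by
    have h := integral_mul_scoreResidual g hA2 π₀ (v := fun _ => 1) contMDiff_const a
    simpa only [one_mul, gradInner_const_left, integral_zero] using h
  have hψ0 : ∀ a, ∫ y, ψ a y ∂ν = 0 := fun a => by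
    simp only [hψ]
    rw [integral_finsetSum _ fun c _ => (integrable_of_continuous (hYc c)).const_mul _]
    simp only [integral_const_mul, hY0, mul_zero, Finset.sum_const_zero]
  have hYT : ∀ c b, ∫ y, scoreResidual g t π₀ c y * centredStat μ t π₀ b y ∂ν = W c b :=
    fun c b => by
      have h := integral_mul_scoreResidual g hA2 π₀ (ht1 b) c
      have hsub : ∀ y, scoreResidual g t π₀ c y * centredStat μ t π₀ b y =
          t b y * scoreResidual g t π₀ c y - (∫ z, t b z ∂ν) * scoreResidual g t π₀ c y := fun y => by
        rw [centredStat]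
        ring
      simp only [hsub]
      have hi : Integrable (fun y => t b y * scoreResidual g t π₀ c y) ν :=
        integrable_of_continuous ((htc b).mul (hYc c))
      rw [integral_sub hi ((integrable_of_continuous (hYc c)).const_mul _), integral_const_mul, hY0, mul_zero,
        sub_zero, h]
      simp only [hW, Matrix.of_apply, gradInner_comm g (t b) (t c)]
      rfl
  have hψT : ∀ a b, ∫ y, ψ a y * centredStat μ t π₀ b y ∂ν =
      (1 : Matrix (Fin m) (Fin m) ℝ) a b := fun a b => by
    simp only [hψ, Finset.sum_mul, mul_assoc]
    have hi : ∀ c, Integrable (fun y => scoreResidual g t π₀ c y * centredStat μ t π₀ b y) ν :=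
      fun c => integrable_of_continuous ((hYc c).mul (hTc b))
    rw [integral_finsetSum _ fun c _ => (hi c).const_mul _]
    simp only [integral_const_mul, hYT]
    rw [← Matrix.nonsing_inv_mul W hWu, Matrix.mul_apply]
  have hd : ∀ a y, -laplaceBeltrami g (t a) y =
      ∑ b, gradInner g (t a) (t b) y * π₀ b + ∑ b, (∫ z, gradInner g (t a) (t b) z ∂ν) * ψ b y :=
    fun a y => by
      have h1 : W *ᵥ (W⁻¹ *ᵥ fun c => scoreResidual g t π₀ c y) =
          fun c => scoreResidual g t π₀ c y := by
        rw [Matrix.mulVec_mulVec, Matrix.mul_nonsing_inv W hWu, Matrix.one_mulVec]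
      have h2 : ∑ b, (∫ z, gradInner g (t a) (t b) z ∂ν) * ψ b y = scoreResidual g t π₀ a y :=
        congrFun h1 a
      rw [h2, scoreResidual]
      ring
  have hI := posDef_fisherInformation (μ := μ) htc hA1 π₀
  have hIeq := fisherInformation_eq (μ := μ) htc π₀
  refine ⟨secondMoment ν ψ, posSemidef_secondMoment fun a b =>
    integrable_of_continuous ((hψc a).mul (hψc b)), hI, ?_, ?_⟩
  · rw [hIeq] at hI ⊢
    exact posSemidef_secondMoment_sub_inv (fun a => memLp_two_of_continuous (hψc a))
      (fun a => memLp_two_of_continuous (hTc a)) hI hψT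
  · intro S _ P _ X hX hind
    have hsme : ∀ n x, sme g t n x = empSolution (fun a b => gradInner g (t a) (t b))
        (fun a y => -laplaceBeltrami g (t a) y) n x := fun n x => by
      have : sampleD g t n x = empVector (fun a y => -laplaceBeltrami g (t a) y) n x := by
        ext a
        simp [sampleD, empVector, Finset.sum_neg_distrib]
      rw [sme, this]
      rfl
    simp only [hsme]
    exact asymptotics_empSolution hX hind (fun a b => (hwc a b).measurable)
      (fun a b => integrable_of_continuous (hwc a b)) (posSemidef_gradInner g ht1) hWp
      (fun a => (hψc a).measurable) (fun a => memLp_two_of_continuous (hψc a)) hψ0 hd
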